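/- For a bounded open convex set $\Omega\subset\mathbb{R}^d$, $\Omega\neq\emptyset$ (a bounded convex domain), let $d_\Omega$ be the Hilbert distance: $d_\Omega(p,p)=0$, and for $p\ne q$ in $\Omega$, $d_\Omega(p,q)=\frac12\log\left(\frac{|qa|}{|pa|}\frac{|pb|}{|qb|}\right)$, where the line $pq$ meets $\partial\Omega$ at $a$ and $b$, in the order $a,p,q,b$. Let $B_\Omega(p,R)=\{q\in\Omega : d_\Omega(p,q)\le R\}$. A notion of volume is a family of measures $\operatorname{Vol}_\Omega(A)=\int_A h(\Omega,x)\,dx$ on the bounded convex domains $\Omega\subset\mathbb{R}^d$, given by a density $h(\Omega,x)$ $(x\in\Omega)$ such that: (i) $h$ is continuous in $(\Omega,x)$ for the pointed Hausdorff topology; (ii) $h(\Omega_2,x)\le h(\Omega_1,x)$ if $x\in\Omega_1\subseteq\Omega_2$; (iii) $h(T\Omega,Tx)\,|\det DT(x)|=h(\Omega,x)$ for every projective transformation $T$ that is defined on $\Omega$ and has a bounded image $T\Omega$; (iv) on ellipsoids it is the Riemannian volume of hyperbolic space, i.e. $h(B,x)=(1-|x|^2)^{-(d+1)/2}$ for the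 open unit ball $B$. The asymptotic volume of the Hilbert geometry on $\Omega$, with base point $p\in\Omega$, is $$\operatorname{Asvol}(\Omega)=\liminf_{R\to\infty}\frac{\operatorname{Vol}_\Omega(B_\Omega(p,R))}{R^d}\in[0,\infty].$$ The faces of a closed convex set $K$ are the classes of the equivalence relation on $K$ in which $a\sim b$ if $a=b$ or some open segment contained in $K$ contains $[a,b]$. A maximal flag of a $d$-dimensional convex polytope is a tuple $(f_0,\dots,f_d)$ of its faces such that $f_i$ has dimension $i$ and $f_{i}$ lies in the relative boundary of $f_{i+1}$ for $0\le i<d$. Let $\operatorname{Flags}(\mathcal P)$ be the set of maximal flags of $\mathcal P$. **Theorem.** Let $\mathcal{P}\subset\mathbb{R}^d$ be a convex polytope of dimension $d$, let $\Sigma\subset\mathbb{R}^d$ be a simplex of dimension $d$, and fix a notion of volume. Then, for the Hilbert geometries on the interiors of $\mathcal P$ and $\Sigma$, and for any choice of base points in these interiors, $$\operatorname{Asvol}(\mathcal{P})=\frac{|\operatorname{Flags}(\mathcal{P})|}{(d+1)!}\,\operatorname{Asvol}(\Sigma).$$ -/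

import Mathlib

open scoped ENNReal Nat
open MeasureTheory Filter

namespace HilbertGeometry

/-- Euclidean `d`-space. -/
abbrev Space (d : ℕ) : Type := EuclideanSpace ℝ (Fin d)

/-- A bounded convex domain: a non-empty bounded open convex set. -/
structure IsBoundedConvexDomain {d : ℕ} (Ω : Set (Space d)) : Prop where
  isOpen : IsOpen Ω
  convex : Convex ℝ Ω
  nonempty : Ω.Nonempty
  isBounded : Bornology.IsBounded Ω

/-! ### The Hilbert distance -/

/-- The point where the ray from `p` in the direction `v ≠ 0` leaves the bounded convex
domain `Ω ∋ p`. -/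
noncomputable def exitPoint {d : ℕ} (Ω : Set (Space d)) (p v : Space d) : Space d :=
  p + sSup {t : ℝ | p + t • v ∈ Ω} • v

/-- The cross ratio `[a, p, q, b] = (|qa| / |pa|) (|pb| / |qb|)`. -/
noncomputable def crossRatio {d : ℕ} (a p q b : Space d) : ℝ :=
  (dist q a / dist p a) * (dist p b / dist q b)

open Classical in
/-- The Hilbert distance `d_Ω(p, q) = ½ log [a, p, q, b]`, where `a` and `b` are the boundary
points of `Ω` on the line `pq`, in the order `a, p, q, b`; and `d_Ω(p, p) = 0`. -/
noncomputable def hilbertDist {d : ℕ} (Ω : Set (Space d)) (p q : Space d) : ℝ :=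
  if p = q then 0
  else (1 / 2) * Real.log (crossRatio (exitPoint Ω p (p - q)) p q (exitPoint Ω p (q - p)))

/-- The closed ball `B_Ω(p, R)` of the Hilbert geometry on `Ω`. -/
def hilbertBall {d : ℕ} (Ω : Set (Space d)) (p : Space d) (R : ℝ) : Set (Space d) :=
  {q ∈ Ω | hilbertDist Ω p q ≤ R}

/-! ### Notions of volume -/

/-- The projective transformation of `ℝ^d` that an invertible linear map `L` of `ℝ^d × ℝ`
induces in the affine chart `x ↦ (x, 1)`. It is defined at the points `x` for which the last
coordinate of `L (x, 1)` is non-zero. -/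
noncomputable def projMap {d : ℕ} (L : (Space d × ℝ) ≃ₗ[ℝ] (Space d × ℝ)) (x : Space d) :
    Space d :=
  (L (x, 1)).2⁻¹ • (L (x, 1)).1

/-- `h` is the density of a notion of volume: to every bounded convex domain `Ω` it assigns a
density `h Ω` on `Ω` with respect to Lebesgue measure, such that the four conditions below hold. -/
structure IsVolumeDensity {d : ℕ} (h : Set (Space d) → Space d → ℝ) : Prop where
  /-- Continuity for the pointed Hausdorff topology on the pairs `(Ω, x)` with `x ∈ Ω`. -/
  continuous : ∀ (Ω : Set (Space d)) (x : Space d), IsBoundedConvexDomain Ω → x ∈ Ω →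
    ∀ ε > 0, ∃ δ > 0, ∀ (Ω' : Set (Space d)) (x' : Space d), IsBoundedConvexDomain Ω' → x' ∈ Ω' →
      Metric.hausdorffDist Ω' Ω < δ → dist x' x < δ → |h Ω' x' - h Ω x| < ε
  /-- Monotonicity for inclusion: a smaller domain has a larger volume. -/
  anti : ∀ (Ω₁ Ω₂ : Set (Space d)) (x : Space d), IsBoundedConvexDomain Ω₁ →
    IsBoundedConvexDomain Ω₂ → Ω₁ ⊆ Ω₂ → x ∈ Ω₁ → h Ω₂ x ≤ h Ω₁ x
  /-- Invariance of the volume under projective transformations (change of variables formula). -/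
  projective : ∀ (L : (Space d × ℝ) ≃ₗ[ℝ] (Space d × ℝ)) (Ω : Set (Space d)) (x : Space d),
    IsBoundedConvexDomain Ω → (∀ y ∈ Ω, (L (y, 1)).2 ≠ 0) →
    IsBoundedConvexDomain (projMap L '' Ω) → x ∈ Ω →
      h (projMap L '' Ω) (projMap L x) * |(fderiv ℝ (projMap L) x).det| = h Ω x
  /-- Normalisation: on the unit ball (hence, by invariance under affine maps, on every
  ellipsoid) it is the density of the Riemannian volume of the Klein model of hyperbolic space. -/
  normalised : ∀ x ∈ Metric.ball (0 : Space d) 1,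
    h (Metric.ball 0 1) x = (1 - ‖x‖ ^ 2) ^ (-((d : ℝ) + 1) / 2)

/-- The volume `Vol_Ω(A)` that belongs to the density `h`. -/
noncomputable def vol {d : ℕ} (h : Set (Space d) → Space d → ℝ) (Ω A : Set (Space d)) : ℝ≥0∞ :=
  ∫⁻ x in A, ENNReal.ofReal (h Ω x)

/-- The asymptotic volume `liminf_{R → ∞} Vol_Ω(B_Ω(p, R)) / R^d` of the Hilbert geometry on `Ω`,
computed with the base point `p`. -/
noncomputable def asvol {d : ℕ} (h : Set (Space d) → Space d → ℝ) (Ω : Set (Space d))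
    (p : Space d) : ℝ≥0∞ :=
  liminf (fun R : ℝ => vol h Ω (hilbertBall Ω p R) / ENNReal.ofReal (R ^ d)) atTop

/-! ### Polytopes, simplices, faces and flags -/

/-- A convex polytope of full dimension `d` in `ℝ^d`. -/
def IsPolytope {d : ℕ} (P : Set (Space d)) : Prop :=
  (∃ s : Finset (Space d), P = convexHull ℝ (s : Set (Space d))) ∧ (interior P).Nonempty

/-- A simplex of full dimension `d` in `ℝ^d`. -/
def IsSimplex {d : ℕ} (S : Set (Space d)) : Prop :=
  ∃ v : Fin (d + 1) → Space d, AffineIndependent ℝ v ∧ S = convexHull ℝ (Set.range v)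

/-- The equivalence relation on a closed convex set `K` whose classes are the faces: `a` and `b`
are equal, or some open segment contained in `K` contains the closed segment `[a, b]`. -/
def FaceRel {d : ℕ} (K : Set (Space d)) (a b : Space d) : Prop :=
  a = b ∨ ∃ c e : Space d, openSegment ℝ c e ⊆ K ∧ segment ℝ a b ⊆ openSegment ℝ c e

/-- A face of `K` (open in its affine hull). -/
def IsFace {d : ℕ} (K F : Set (Space d)) : Prop :=
  ∃ a ∈ K, F = {b ∈ K | FaceRel K a b}

/-- The dimension of the affine hull of a set. -/
noncomputable def affineDim {d : ℕ} (F : Set (Space d)) : ℕ :=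
  Module.finrank ℝ (affineSpan ℝ F).direction

/-- The maximal flags of `P`: tuples `f_0 < f_1 < ... < f_d` of faces with `dim f_i = i`, where
`f < F` means that `f` lies in the relative boundary of `F`. -/
def flags {d : ℕ} (P : Set (Space d)) : Set (Fin (d + 1) → Set (Space d)) :=
  {f | (∀ i, IsFace P (f i)) ∧ (∀ i, affineDim (f i) = (i : ℕ)) ∧
    ∀ i : Fin d, f i.castSucc ⊆ intrinsicFrontier ℝ (f i.succ)}

end HilbertGeometry

/-!
The asymptotic volume of a polytope `P` is a sum over its maximal flags, in which every flag
contributes the same amount `flagConst`, which depends only on the dimension and on the density.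
A simplex has `(d + 1)!` maximal flags (`encard_flags_simplex`), and the theorem follows.

Choose a point in every face of `P`, the base point `p` being chosen in the interior. A flag
`f 0 < ... < f d` yields the simplex whose vertices `v 0, ..., v d = p` are the chosen points, and
these flag simplices form a barycentric subdivision of `P` (`flagSimplices_partition`). A point
`x = ∑ t i • v i` of a flag simplex is described by the cumulative weights
`T i = t i + ... + t d`, so that `1 = T 0 > T 1 > ... > T d > 0`. Two facts describe the Hilbert
geometry of `P` there.

* Since `v 0, ..., v (d - 1)` lie in a common facet, `T d` is one minus the gauge of `x - p`. Hence
  `d(p, x) = ½ log (1 / T d) + O(1)` (`hilbertDist_eq`, `gauge_flagPoint`).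
* The density of an open simplex is a constant divided by the volume and by the product of the
  barycentric coordinates, because projective transformations act transitively on the simplex
  (`density_openSimplex`). The polytope lies between an inner and an outer simplex with the same
  flag (`exists_inner_frame`, `exists_outer_frame`); the outer one exists because faces of
  polytopes are exposed (`exists_exposing`, a consequence of Farkas' lemma). By monotonicity the
  density of `P`, multiplied by the volume form of the weights and by `T 1 ⋯ T d`, is bounded, and
  it converges to a universal constant when all the quotients `T (i + 1) / T i` tend to zero
  (`tendsto_density_flagPoint`).

In the coordinates `T i = exp (-R s i)` the volume of the part of the ball of radius `R` that lies
in the flag simplex, divided by `R ^ d`, is an integral over `0 < s 1 < ... < s d`, restricted to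
about `s d < 2`. Dominated convergence gives the limit `flagConst` (`tendsto_vol_flagSimplex`).
-/

namespace HilbertGeometry

/-! ### The Hilbert distance in terms of the gauge -/

/-- The domain `Ω` translated so that the point `p` becomes the origin. -/
def centered {d : ℕ} (Ω : Set (Space d)) (p : Space d) : Set (Space d) := {v | p + v ∈ Ω}

section Centered

variable {d : ℕ} {Ω : Set (Space d)} {p : Space d}

lemma isOpen_centered (hΩ : IsBoundedConvexDomain Ω) : IsOpen (centered Ω p) :=
  hΩ.isOpen.preimage (continuous_const.add continuous_id)

lemma convex_centered (hΩ : IsBoundedConvexDomain Ω) : Convex ℝ (centered Ω p) := by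
  intro x hx y hy a b ha hb hab
  have := hΩ.convex hx hy ha hb hab
  change p + (a • x + b • y) ∈ Ω
  convert this using 1
  rw [smul_add, smul_add, add_add_add_comm, ← add_smul, hab, one_smul]

lemma isBounded_centered (hΩ : IsBoundedConvexDomain Ω) :
    Bornology.IsBounded (centered Ω p) := by
  obtain ⟨r, hr⟩ := hΩ.isBounded.subset_closedBall p
  refine (Metric.isBounded_closedBall (x := (0 : Space d)) (r := r)).subset fun v hv => ?_
  have := hr hv
  simpa using this

lemma centered_mem_nhds (hΩ : IsBoundedConvexDomain Ω) (hp : p ∈ Ω) :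
    centered Ω p ∈ nhds (0 : Space d) :=
  (isOpen_centered hΩ).mem_nhds (by simpa [centered] using hp)

lemma gauge_centered_lt_one_iff (hΩ : IsBoundedConvexDomain Ω) (hp : p ∈ Ω) (v : Space d) :
    gauge (centered Ω p) v < 1 ↔ p + v ∈ Ω := by
  rw [gauge_lt_one_iff_mem_interior (convex_centered hΩ) (centered_mem_nhds hΩ hp),
    (isOpen_centered hΩ).interior_eq]
  rfl

lemma gauge_centered_pos (hΩ : IsBoundedConvexDomain Ω) (hp : p ∈ Ω) {v : Space d}
    (hv : v ≠ 0) : 0 < gauge (centered Ω p) v :=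
  (gauge_pos (absorbent_nhds_zero (centered_mem_nhds hΩ hp))
    (NormedSpace.isVonNBounded_of_isBounded ℝ (isBounded_centered hΩ))).2 hv

lemma exitPoint_eq (hΩ : IsBoundedConvexDomain Ω) (hp : p ∈ Ω) {v : Space d} (hv : v ≠ 0) :
    exitPoint Ω p v = p + (gauge (centered Ω p) v)⁻¹ • v := by
  have hg := gauge_centered_pos hΩ hp hv
  have key : ∀ t : ℝ, 0 ≤ t → (p + t • v ∈ Ω ↔ t < (gauge (centered Ω p) v)⁻¹) := by
    intro t ht
    rw [← gauge_centered_lt_one_iff hΩ hp, gauge_smul_of_nonneg ht, smul_eq_mul,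
      ← one_div, lt_div_iff₀ hg]
  have hsup : sSup {t : ℝ | p + t • v ∈ Ω} = (gauge (centered Ω p) v)⁻¹ := by
    refine csSup_eq_of_forall_le_of_forall_lt_exists_gt ⟨0, by simpa using hp⟩ ?_ ?_
    · intro t ht
      rcases le_or_gt 0 t with h0 | h0
      · exact ((key t h0).1 ht).le
      · exact h0.le.trans (inv_nonneg.2 hg.le)
    · intro w hw
      obtain ⟨t, ht1, ht2⟩ := exists_between (max_lt hw (inv_pos.2 hg))
      exact ⟨t, (key t ((le_max_right _ _).trans ht1.le)).2 ht2, (le_max_left _ _).trans_lt ht1⟩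
  rw [exitPoint, hsup]

/-- With the origin at `p`, the Hilbert distance is
`½ log ((1 + g (p - x)) / (1 - g (x - p)))`, where `g` is the gauge of the domain. -/
lemma hilbertDist_eq (hΩ : IsBoundedConvexDomain Ω) (hp : p ∈ Ω) {x : Space d} (hx : x ∈ Ω) :
    hilbertDist Ω p x = (1 / 2) * Real.log
      ((1 + gauge (centered Ω p) (p - x)) / (1 - gauge (centered Ω p) (x - p))) := by
  by_cases hpx : p = x
  · simp [hilbertDist, hpx, gauge_zero]
  have h1 : p - x ≠ 0 := sub_ne_zero.2 hpx
  have h2 : x - p ≠ 0 := sub_ne_zero.2 (Ne.symm hpx)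
  rw [hilbertDist, if_neg hpx, exitPoint_eq hΩ hp h1, exitPoint_eq hΩ hp h2, crossRatio]
  have hg1 := gauge_centered_pos hΩ hp h1
  have hg2 := gauge_centered_pos hΩ hp h2
  have hg3 : gauge (centered Ω p) (x - p) < 1 := by
    rw [gauge_centered_lt_one_iff hΩ hp]; simpa using hx
  set g₁ := gauge (centered Ω p) (p - x)
  set g₂ := gauge (centered Ω p) (x - p)
  have hn : 0 < ‖x - p‖ := norm_pos_iff.2 h2
  have e1 : dist x (p + g₁⁻¹ • (p - x)) = (1 + g₁⁻¹) * ‖x - p‖ := by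
    rw [dist_eq_norm, show x - (p + g₁⁻¹ • (p - x)) = (1 + g₁⁻¹) • (x - p) by module,
      norm_smul, Real.norm_of_nonneg (by positivity)]
  have e2 : dist p (p + g₁⁻¹ • (p - x)) = g₁⁻¹ * ‖x - p‖ := by
    rw [dist_eq_norm, show p - (p + g₁⁻¹ • (p - x)) = g₁⁻¹ • (x - p) by module,
      norm_smul, Real.norm_of_nonneg (by positivity)]
  have e3 : dist p (p + g₂⁻¹ • (x - p)) = g₂⁻¹ * ‖x - p‖ := by
    rw [dist_comm, dist_eq_norm, show (p + g₂⁻¹ • (x - p)) - p = g₂⁻¹ • (x - p) by module,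
      norm_smul, Real.norm_of_nonneg (by positivity)]
  have h4 : 0 < g₂⁻¹ - 1 := sub_pos.2 ((one_lt_inv₀ hg2).2 hg3)
  have e4 : dist x (p + g₂⁻¹ • (x - p)) = (g₂⁻¹ - 1) * ‖x - p‖ := by
    rw [dist_comm, dist_eq_norm,
      show (p + g₂⁻¹ • (x - p)) - x = (g₂⁻¹ - 1) • (x - p) by module,
      norm_smul, Real.norm_of_nonneg h4.le]
  rw [e1, e2, e3, e4]
  have h5 : 1 - g₂ ≠ 0 := (sub_pos.2 hg3).ne'
  have h6 : g₂⁻¹ - 1 = (1 - g₂) / g₂ := by field_simp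
  rw [h6]
  congr 2
  field_simp
  ring

lemma mem_hilbertBall_iff (hΩ : IsBoundedConvexDomain Ω) (hp : p ∈ Ω) {x : Space d} {R : ℝ} :
    x ∈ hilbertBall Ω p R ↔ x ∈ Ω ∧
      1 + gauge (centered Ω p) (p - x) ≤
        Real.exp (2 * R) * (1 - gauge (centered Ω p) (x - p)) := by
  refine and_congr_right fun hx => ?_
  have hg3 : gauge (centered Ω p) (x - p) < 1 := by
    rw [gauge_centered_lt_one_iff hΩ hp]; simpa using hx
  have hg1 : 0 ≤ gauge (centered Ω p) (p - x) := gauge_nonneg _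
  have h5 : 0 < 1 - gauge (centered Ω p) (x - p) := sub_pos.2 hg3
  rw [hilbertDist_eq hΩ hp hx, ← div_le_iff₀ h5, ← Real.log_le_iff_le_exp (by positivity)]
  constructor <;> intro h <;> linarith

lemma measurableSet_hilbertBall (hΩ : IsBoundedConvexDomain Ω) (hp : p ∈ Ω) (R : ℝ) :
    MeasurableSet (hilbertBall Ω p R) := by
  have hc : Continuous (gauge (centered Ω p)) :=
    continuous_gauge (convex_centered hΩ) (centered_mem_nhds hΩ hp)
  have : hilbertBall Ω p R = Ω ∩ {x | 1 + gauge (centered Ω p) (p - x) ≤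
        Real.exp (2 * R) * (1 - gauge (centered Ω p) (x - p))} := by
    ext x
    exact mem_hilbertBall_iff hΩ hp
  rw [this]
  refine hΩ.isOpen.measurableSet.inter (IsClosed.measurableSet (isClosed_le ?_ ?_))
  · exact continuous_const.add (hc.comp (continuous_const.sub continuous_id))
  · exact continuous_const.mul
      (continuous_const.sub (hc.comp (continuous_id.sub continuous_const)))

lemma exists_gauge_centered_bound (hΩ : IsBoundedConvexDomain Ω) (hp : p ∈ Ω) :
    ∃ K : ℝ, ∀ x ∈ Ω, gauge (centered Ω p) (p - x) ≤ K := by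
  have hc : Continuous (gauge (centered Ω p)) :=
    continuous_gauge (convex_centered hΩ) (centered_mem_nhds hΩ hp)
  have hK := hΩ.isBounded.isCompact_closure
  obtain ⟨K, hK⟩ := (hK.image (hc.comp (continuous_const.sub continuous_id) :
    Continuous fun x => gauge (centered Ω p) (p - x))).bddAbove
  exact ⟨K, fun x hx => hK ⟨x, subset_closure hx, rfl⟩⟩

end Centered

/-! ### The derivative of a projective transformation -/

section Projective

variable {d : ℕ}

/-- The derivative at `x` of the projective transformation induced by `L`. -/
noncomputable def projDeriv (L : (Space d × ℝ) ≃ₗ[ℝ] (Space d × ℝ)) (x : Space d) :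
    Space d →L[ℝ] Space d :=
  let Lc : Space d →L[ℝ] Space d × ℝ :=
    (L.toContinuousLinearEquiv : (Space d × ℝ) →L[ℝ] (Space d × ℝ)).comp
      (ContinuousLinearMap.inl ℝ (Space d) ℝ)
  (L (x, 1)).2⁻¹ • (ContinuousLinearMap.fst ℝ (Space d) ℝ).comp Lc -
    ((((L (x, 1)).2 ^ 2)⁻¹ • (ContinuousLinearMap.snd ℝ (Space d) ℝ).comp Lc).smulRight
      (L (x, 1)).1)

lemma projDeriv_apply (L : (Space d × ℝ) ≃ₗ[ℝ] (Space d × ℝ)) (x v : Space d) :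
    projDeriv L x v =
      (L (x, 1)).2⁻¹ • (L (v, 0)).1 - (((L (x, 1)).2 ^ 2)⁻¹ * (L (v, 0)).2) • (L (x, 1)).1 := by
  simp [projDeriv]

lemma hasFDerivAt_projMap (L : (Space d × ℝ) ≃ₗ[ℝ] (Space d × ℝ)) {x : Space d}
    (hx : (L (x, 1)).2 ≠ 0) : HasFDerivAt (projMap L) (projDeriv L x) x := by
  have h0 : HasFDerivAt (fun y : Space d => L (y, 1))
      ((L.toContinuousLinearEquiv : (Space d × ℝ) →L[ℝ] (Space d × ℝ)).comp
      (ContinuousLinearMap.inl ℝ (Space d) ℝ)) x :=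
    (L.toContinuousLinearEquiv : (Space d × ℝ) →L[ℝ] (Space d × ℝ)).hasFDerivAt.comp x
      (hasFDerivAt_prodMk_left x (1 : ℝ))
  have h1 : HasFDerivAt (fun y : Space d => (L (y, 1)).1) _ x := h0.fst
  have h2 : HasFDerivAt (fun y : Space d => (L (y, 1)).2) _ x := h0.snd
  have h3 := ((hasDerivAt_inv hx).comp_hasFDerivAt x h2).smul h1
  refine h3.congr_fderiv ?_
  ext1 v
  rw [projDeriv_apply]
  simp [sub_eq_add_neg]

lemma det_projDeriv (L : (Space d × ℝ) ≃ₗ[ℝ] (Space d × ℝ)) {x : Space d}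
    (hx : (L (x, 1)).2 ≠ 0) :
    (projDeriv L x).det * (L (x, 1)).2 ^ (d + 1) =
      LinearMap.det (L : (Space d × ℝ) →ₗ[ℝ] (Space d × ℝ)) := by
  set N := (L (x, 1)).1 with hN
  set D := (L (x, 1)).2 with hD
  have hL : L (x, 1) = (N, D) := rfl
  -- `L` is block triangular up to shears, with diagonal blocks `D • projDeriv L x` and `D`.
  let s : Module.Dual ℝ (Space d × ℝ) := LinearMap.snd ℝ (Space d) ℝ
  let f : Module.Dual ℝ (Space d × ℝ) :=
    (s ∘ₗ (L : (Space d × ℝ) →ₗ[ℝ] _)) ∘ₗ (LinearMap.inl ℝ (Space d) ℝ) ∘ₗ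
      (LinearMap.fst ℝ (Space d) ℝ) + (D - 1) • s
  have key : (LinearMap.transvection s (-(D⁻¹ • N), 0)) ∘ₗ
      (L : (Space d × ℝ) →ₗ[ℝ] (Space d × ℝ)) ∘ₗ (LinearMap.transvection s (x, 0)) =
      (LinearMap.prodMap (D • (projDeriv L x : Space d →ₗ[ℝ] Space d)) LinearMap.id) ∘ₗ
        (LinearMap.transvection f (0, 1)) := by
    refine LinearMap.ext fun z => ?_
    obtain ⟨v, t⟩ := z
    have e1 : L (v + t • x, t) = L (v, 0) + t • (N, D) := by
      rw [← hL, ← map_smul, ← map_add]; simp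
    have e2 : L ((v, t) + t • (x, 0)) = L (v, 0) + t • (N, D) := by
      rw [← e1]; simp
    simp only [LinearMap.comp_apply, LinearMap.transvection.apply, LinearEquiv.coe_coe,
      LinearMap.prodMap_apply, s, f, LinearMap.snd_apply, e2, LinearMap.add_apply,
      LinearMap.smul_apply, LinearMap.fst_apply, LinearMap.inl_apply, LinearMap.id_apply]
    ext1
    · have h1 : ((L (v, 0)).2 + t * D) * D⁻¹ = (L (v, 0)).2 * D⁻¹ + t := by field_simp
      have h2 : D * ((D ^ 2)⁻¹ * (L (v, 0)).2) = (L (v, 0)).2 * D⁻¹ := by field_simp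
      simp [projDeriv_apply, smul_sub, smul_smul]
      rw [← hN, ← hD, mul_inv_cancel₀ hx, h1, h2]
      module
    · simp
      ring
  have hdet := congrArg LinearMap.det key
  rw [LinearMap.det_comp, LinearMap.det_comp, LinearMap.det_comp, LinearMap.det_prodMap,
    LinearMap.transvection.det, LinearMap.transvection.det, LinearMap.transvection.det,
    LinearMap.det_smul, LinearMap.det_id] at hdet
  have hL0 : L (0, 0) = 0 := map_zero L
  simp [s, f, hL0] at hdet
  rw [hdet, ContinuousLinearMap.det]
  ring

end Projective

/-! ### The staircase simplex -/

section Staircase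

variable {d : ℕ}

lemma sum_Ici_castSucc {d : ℕ} (f : Fin (d + 1) → ℝ) (j : Fin d) :
    ∑ k ∈ Finset.Ici j.castSucc, f k = f j.castSucc + ∑ k ∈ Finset.Ici j.succ, f k := by
  have : Finset.Ici j.castSucc = insert j.castSucc (Finset.Ici j.succ) := by
    ext k
    simp only [Finset.mem_Ici, Finset.mem_insert, Fin.le_def, Fin.ext_iff, Fin.val_castSucc,
      Fin.val_succ]
    omega
  rw [this, Finset.sum_insert]
  simp [Fin.le_def]

/-- The barycentric weights `t i = T i - T (i + 1)` that belong to cumulative weights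
`T 0 = s`, `T 1`, ..., `T d`, followed by `T (d + 1) = 0`. -/
def weights (s : ℝ) (T : Fin d → ℝ) (i : Fin (d + 1)) : ℝ :=
  (Fin.cons s T : Fin (d + 1) → ℝ) i - (Fin.snoc T 0 : Fin (d + 1) → ℝ) i

lemma sum_Ici_weights (s : ℝ) (T : Fin d → ℝ) (i : Fin (d + 1)) :
    ∑ k ∈ Finset.Ici i, weights s T k = (Fin.cons s T : Fin (d + 1) → ℝ) i := by
  induction i using Fin.reverseInduction with
  | last =>
    have : Finset.Ici (Fin.last d) = {Fin.last d} := by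
      ext k; simp [Fin.last_le_iff]
    rw [this]; simp [weights]
  | cast j ih => rw [sum_Ici_castSucc, ih]; simp [weights]

lemma sum_weights (s : ℝ) (T : Fin d → ℝ) : ∑ k, weights s T k = s := by
  have := sum_Ici_weights s T 0
  rwa [show Finset.Ici (0 : Fin (d + 1)) = Finset.univ by ext; simp, Fin.cons_zero] at this

/-- The weights as a linear function of the cumulative weights. -/
def weightsLinear (d : ℕ) : (Space d × ℝ) →ₗ[ℝ] (Fin (d + 1) → ℝ) where
  toFun z := weights z.2 z.1
  map_add' z w := by
    ext i
    have h1 : (Fin.cons (z + w).2 (z + w).1.ofLp : Fin (d + 1) → ℝ) i =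
        (Fin.cons z.2 z.1.ofLp : Fin (d + 1) → ℝ) i +
          (Fin.cons w.2 w.1.ofLp : Fin (d + 1) → ℝ) i := by
      refine Fin.cases ?_ (fun j => ?_) i <;> simp
    have h2 : (Fin.snoc (z + w).1.ofLp 0 : Fin (d + 1) → ℝ) i =
        (Fin.snoc z.1.ofLp 0 : Fin (d + 1) → ℝ) i +
          (Fin.snoc w.1.ofLp 0 : Fin (d + 1) → ℝ) i := by
      refine Fin.lastCases ?_ (fun j => ?_) i <;> simp
    simp only [weights, Pi.add_apply, h1, h2]
    ring
  map_smul' c z := by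
    ext i
    have h1 : (Fin.cons (c • z).2 (c • z).1.ofLp : Fin (d + 1) → ℝ) i =
        c * (Fin.cons z.2 z.1.ofLp : Fin (d + 1) → ℝ) i := by
      refine Fin.cases ?_ (fun j => ?_) i <;> simp
    have h2 : (Fin.snoc (c • z).1.ofLp 0 : Fin (d + 1) → ℝ) i =
        c * (Fin.snoc z.1.ofLp 0 : Fin (d + 1) → ℝ) i := by
      refine Fin.lastCases ?_ (fun j => ?_) i <;> simp
    simp only [weights, Pi.smul_apply, smul_eq_mul, h1, h2, RingHom.id_apply]
    ring

lemma weightsLinear_injective (d : ℕ) : Function.Injective (weightsLinear d) := by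
  rw [injective_iff_map_eq_zero]
  rintro ⟨x, s⟩ hz
  have h : ∀ i, (Fin.cons s x.ofLp : Fin (d + 1) → ℝ) i = 0 := by
    intro i
    rw [← sum_Ici_weights s x.ofLp i]
    exact Finset.sum_eq_zero fun k _ => congrFun hz k
  have h0 : s = 0 := by simpa using h 0
  have h1 : x = 0 := by
    ext j
    simpa using h j.succ
  simp [h0, h1]

/-- The basis of `ℝ^d × ℝ` that consists of the points `(b₁ + ... + b_k, 1)`, `0 ≤ k ≤ d`, where
`b` is the standard basis; it is given by its coordinates. -/
noncomputable def stairBasis (d : ℕ) : Module.Basis (Fin (d + 1)) ℝ (Space d × ℝ) :=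
  Module.Basis.ofEquivFun
    ((weightsLinear d).linearEquivOfInjective (weightsLinear_injective d) (by simp))

lemma stairBasis_repr (z : Space d × ℝ) (i : Fin (d + 1)) :
    (stairBasis d).repr z i = weights z.2 z.1 i := by
  simp [stairBasis, LinearMap.linearEquivOfInjective_apply, weightsLinear]

lemma sum_stairBasis_repr (z : Space d × ℝ) : ∑ i, (stairBasis d).repr z i = z.2 := by
  simp_rw [stairBasis_repr, sum_weights]

lemma stairBasis_snd (i : Fin (d + 1)) : (stairBasis d i).2 = 1 := by
  rw [← sum_stairBasis_repr]
  simp [Finsupp.single_apply]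

end Staircase

/-! ### The density of a notion of volume on a simplex -/

/-- A frame: a basis of `ℝ^d × ℝ` that consists of points `(u, 1)`, that is, of lifts of the
vertices `u` of a simplex. The coordinates of `(x, 1)` are the barycentric coordinates of `x`. -/
def IsFrame {d : ℕ} (B : Module.Basis (Fin (d + 1)) ℝ (Space d × ℝ)) : Prop :=
  ∀ i, (B i).2 = 1

/-- The open simplex whose vertices are the points of the frame `B`. -/
def openSimplex {d : ℕ} (B : Module.Basis (Fin (d + 1)) ℝ (Space d × ℝ)) : Set (Space d) :=
  {x | ∀ i, 0 < B.repr (x, 1) i}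

section Simplex

variable {d : ℕ} {B : Module.Basis (Fin (d + 1)) ℝ (Space d × ℝ)}

lemma isFrame_stairBasis (d : ℕ) : IsFrame (stairBasis d) := stairBasis_snd

lemma IsFrame.sum_repr (hB : IsFrame B) (z : Space d × ℝ) : ∑ i, B.repr z i = z.2 := by
  have := congrArg Prod.snd (B.sum_repr z)
  rw [Prod.snd_sum] at this
  simpa only [Prod.smul_snd, hB _, smul_eq_mul, mul_one] using this

lemma sum_repr_smul_fst (z : Space d × ℝ) : ∑ i, B.repr z i • (B i).1 = z.1 := by
  have := congrArg Prod.fst (B.sum_repr z)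
  rw [Prod.fst_sum] at this
  simpa only [Prod.smul_fst] using this

lemma continuous_repr (B : Module.Basis (Fin (d + 1)) ℝ (Space d × ℝ)) (i : Fin (d + 1)) :
    Continuous fun x : Space d => B.repr (x, 1) i := by
  have h := (B.coord i).continuous_of_finiteDimensional
  exact h.comp (continuous_id.prodMk continuous_const)

/-- The centroid of the simplex with frame `B`. -/
noncomputable def centroid (B : Module.Basis (Fin (d + 1)) ℝ (Space d × ℝ)) : Space d :=
  ∑ i, ((d : ℝ) + 1)⁻¹ • (B i).1

lemma IsFrame.centroid_lift (hB : IsFrame B) :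
    ((centroid B, 1) : Space d × ℝ) = ∑ i, ((d : ℝ) + 1)⁻¹ • B i := by
  have h : ((d : ℝ) + 1) ≠ 0 := by positivity
  ext1
  · simp [centroid, Prod.fst_sum]
  · simp [Prod.snd_sum, hB _, h]

lemma IsFrame.centroid_repr (hB : IsFrame B) (i : Fin (d + 1)) :
    B.repr (centroid B, 1) i = ((d : ℝ) + 1)⁻¹ := by
  rw [hB.centroid_lift, map_sum, Finsupp.finsetSum_apply]
  simp [Finsupp.single_apply]

lemma IsFrame.centroid_mem (hB : IsFrame B) : centroid B ∈ openSimplex B := fun i => by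
  rw [hB.centroid_repr]; positivity

lemma IsFrame.repr_le_one (hB : IsFrame B) {x : Space d} (hx : x ∈ openSimplex B)
    (i : Fin (d + 1)) : B.repr (x, 1) i ≤ 1 := by
  have h := hB.sum_repr (x, 1)
  refine le_of_le_of_eq ?_ h
  exact Finset.single_le_sum (fun j _ => (hx j).le) (Finset.mem_univ i)

lemma isOpen_openSimplex (B : Module.Basis (Fin (d + 1)) ℝ (Space d × ℝ)) :
    IsOpen (openSimplex B) := by
  have : openSimplex B = ⋂ i, {x | 0 < B.repr (x, 1) i} := by
    ext x; simp [openSimplex]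
  rw [this]
  exact isOpen_iInter_of_finite fun i => isOpen_lt continuous_const (continuous_repr B i)

lemma IsFrame.isBoundedConvexDomain (hB : IsFrame B) : IsBoundedConvexDomain (openSimplex B) where
  isOpen := isOpen_openSimplex B
  nonempty := ⟨_, hB.centroid_mem⟩
  convex := by
    intro x hx y hy a b ha hb hab i
    have : ((a • x + b • y, 1) : Space d × ℝ) = a • (x, (1 : ℝ)) + b • (y, (1 : ℝ)) := by
      ext1 <;> simp [hab]
    rw [this, map_add, map_smul, map_smul]
    simp only [Finsupp.add_apply, Finsupp.smul_apply, smul_eq_mul]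
    rcases ha.eq_or_lt with rfl | ha
    · have : b = 1 := by simpa using hab
      simp [this, hy i]
    · exact add_pos_of_pos_of_nonneg (mul_pos ha (hx i)) (mul_nonneg hb (hy i).le)
  isBounded := by
    rw [isBounded_iff_forall_norm_le]
    refine ⟨∑ i, ‖(B i).1‖, fun x hx => ?_⟩
    rw [← show ∑ i, B.repr (x, 1) i • (B i).1 = x from sum_repr_smul_fst (x, 1)]
    refine norm_sum_le_of_le _ fun i _ => ?_
    rw [norm_smul, Real.norm_of_nonneg (hx i).le]
    exact mul_le_of_le_one_left (norm_nonneg _) (hB.repr_le_one hx i)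

/-- The linear map that takes the points of the frame `A` to multiples of the points of the
frame `B`; it induces a projective transformation between the simplices. -/
noncomputable def frameMap (A B : Module.Basis (Fin (d + 1)) ℝ (Space d × ℝ))
    (m : Fin (d + 1) → ℝˣ) : (Space d × ℝ) ≃ₗ[ℝ] (Space d × ℝ) :=
  A.equiv (B.unitsSMul m) (Equiv.refl _)

variable {A : Module.Basis (Fin (d + 1)) ℝ (Space d × ℝ)} {m : Fin (d + 1) → ℝˣ}

lemma frameMap_apply (z : Space d × ℝ) :
    frameMap A B m z = ∑ i, (A.repr z i * m i) • B i := by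
  conv_lhs => rw [← A.sum_repr z, map_sum]
  refine Finset.sum_congr rfl fun i _ => ?_
  rw [map_smul, frameMap, Module.Basis.equiv_apply, Equiv.refl_apply,
    Module.Basis.unitsSMul_apply, Units.smul_def, smul_smul]

lemma repr_frameMap (z : Space d × ℝ) (i : Fin (d + 1)) :
    B.repr (frameMap A B m z) i = A.repr z i * m i := by
  rw [frameMap_apply, map_sum, Finsupp.finsetSum_apply]
  simp [Finsupp.single_apply]

lemma det_frameMap :
    LinearMap.det (frameMap A B m : (Space d × ℝ) →ₗ[ℝ] (Space d × ℝ)) =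
      (∏ i, (m i : ℝ)) * A.det B := by
  rw [frameMap, Module.Basis.det_basis]
  have : (⇑(B.unitsSMul m) : Fin (d + 1) → Space d × ℝ) = fun i => (m i : ℝ) • B i := by
    ext1 i
    rw [Module.Basis.unitsSMul_apply, Units.smul_def]
  rw [this, AlternatingMap.map_smul_univ, smul_eq_mul]

lemma projMap_of_eq_smul {L : (Space d × ℝ) ≃ₗ[ℝ] (Space d × ℝ)} {x y : Space d} {c : ℝ}
    (hc : c ≠ 0) (h : L (x, 1) = c • (y, 1)) : projMap L x = y := by
  simp [projMap, h, smul_smul, hc]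

lemma frameMap_snd_pos (hB : IsFrame B) (hm : ∀ i, 0 < (m i : ℝ)) {x : Space d}
    (hx : x ∈ openSimplex A) : 0 < (frameMap A B m (x, 1)).2 := by
  rw [← hB.sum_repr]
  refine Finset.sum_pos (fun i _ => ?_) Finset.univ_nonempty
  rw [repr_frameMap]
  exact mul_pos (hx i) (hm i)

lemma lift_projMap (L : (Space d × ℝ) ≃ₗ[ℝ] (Space d × ℝ)) {x : Space d}
    (hx : (L (x, 1)).2 ≠ 0) : (projMap L x, (1 : ℝ)) = (L (x, 1)).2⁻¹ • L (x, 1) := by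
  ext1 <;> simp [projMap, hx]

lemma image_projMap_frameMap (hA : IsFrame A) (hB : IsFrame B) (hm : ∀ i, 0 < (m i : ℝ)) :
    projMap (frameMap A B m) '' openSimplex A = openSimplex B := by
  ext y
  constructor
  · rintro ⟨x, hx, rfl⟩ i
    have hpos := frameMap_snd_pos hB hm hx
    rw [lift_projMap _ hpos.ne', map_smul, Finsupp.smul_apply, repr_frameMap, smul_eq_mul]
    exact mul_pos (inv_pos.2 hpos) (mul_pos (hx i) (hm i))
  · intro hy
    set z := (frameMap A B m).symm (y, 1) with hz
    have hLz : frameMap A B m z = (y, 1) := LinearEquiv.apply_symm_apply _ _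
    have hzi : ∀ i, 0 < A.repr z i := by
      intro i
      have h := repr_frameMap (A := A) (B := B) (m := m) z i
      rw [hLz] at h
      exact pos_of_mul_pos_left (h ▸ hy i) (hm i).le
    have hz2 : 0 < z.2 := by
      rw [← hA.sum_repr]
      exact Finset.sum_pos (fun i _ => hzi i) Finset.univ_nonempty
    have hlift : ((z.2⁻¹ • z.1, 1) : Space d × ℝ) = z.2⁻¹ • z := by
      ext1 <;> simp [hz2.ne']
    refine ⟨z.2⁻¹ • z.1, fun i => ?_, ?_⟩
    · rw [hlift, map_smul, Finsupp.smul_apply, smul_eq_mul]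
      exact mul_pos (inv_pos.2 hz2) (hzi i)
    · refine projMap_of_eq_smul (inv_ne_zero hz2.ne') ?_
      rw [hlift, map_smul, hLz]

/-- The density of a notion of volume at the centroid of the staircase simplex, normalised so
that it is the constant in `density_openSimplex`. -/
noncomputable def simplexConst (d : ℕ) (h : Set (Space d) → Space d → ℝ) : ℝ :=
  h (openSimplex (stairBasis d)) (centroid (stairBasis d)) * (((d : ℝ) + 1)⁻¹) ^ (d + 1)

/-- On a simplex the density is a constant divided by the product of the barycentric coordinates
and by the volume, because the projective transformations that preserve an open simplex act
transitively on it. -/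
lemma density_openSimplex {h : Set (Space d) → Space d → ℝ} (hh : IsVolumeDensity h)
    (hB : IsFrame B) {x : Space d} (hx : x ∈ openSimplex B) :
    h (openSimplex B) x * |(stairBasis d).det B| * ∏ i, B.repr (x, 1) i = simplexConst d h := by
  set A := stairBasis d with hAdef
  have hA : IsFrame A := isFrame_stairBasis d
  let m : Fin (d + 1) → ℝˣ := fun i => Units.mk0 (B.repr (x, 1) i) (hx i).ne'
  have hm : ∀ i, 0 < (m i : ℝ) := hx
  set L := frameMap A B m with hL
  have hd : (0 : ℝ) < ((d : ℝ) + 1)⁻¹ := by positivity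
  have hLc : L (centroid A, 1) = ((d : ℝ) + 1)⁻¹ • (x, (1 : ℝ)) := by
    rw [frameMap_apply]
    conv_rhs => rw [← B.sum_repr (x, 1), Finset.smul_sum]
    refine Finset.sum_congr rfl fun i _ => ?_
    rw [hA.centroid_repr, smul_smul]
    rfl
  have hLx : projMap L (centroid A) = x := projMap_of_eq_smul hd.ne' hLc
  have hL2 : (L (centroid A, 1)).2 = ((d : ℝ) + 1)⁻¹ := by rw [hLc]; simp
  have himg := image_projMap_frameMap hA hB hm
  have key := hh.projective L (openSimplex A) (centroid A) hA.isBoundedConvexDomain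
    (fun y hy => (frameMap_snd_pos hB hm hy).ne') (himg ▸ hB.isBoundedConvexDomain)
    hA.centroid_mem
  rw [himg, hLx, (hasFDerivAt_projMap L (by rw [hL2]; exact hd.ne')).fderiv] at key
  have hdet := det_projDeriv L (x := centroid A) (by rw [hL2]; exact hd.ne')
  rw [det_frameMap, hL2] at hdet
  have habs := congrArg abs hdet
  rw [abs_mul, abs_mul, abs_of_pos (pow_pos hd _), abs_of_pos (Finset.prod_pos fun i _ => hm i)]
    at habs
  rw [simplexConst, ← hAdef, ← key, mul_assoc, mul_assoc, habs, mul_comm |A.det B|]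
  rfl

end Simplex

/-! ### Simplices adapted to a flag -/

/-- The frame `B` is adapted to the frame `V`: for every `j` the vertex `V j` lies in the open face
that is spanned by the vertices `B 0, ..., B j`. For an outer simplex some of the vertices of `B`
lie outside the polytope, but its faces still induce the flag given by `V`. -/
def IsAdapted {d : ℕ} (B V : Module.Basis (Fin (d + 1)) ℝ (Space d × ℝ)) : Prop :=
  (∀ i j, j < i → B.repr (V j) i = 0) ∧ ∀ i j, i ≤ j → 0 < B.repr (V j) i

/-- The point of the simplex with frame `V` whose cumulative barycentric weights, counted from
the last vertex, are `T 0`, ..., `T (d - 1)`. -/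
noncomputable def flagPoint {d : ℕ} (V : Module.Basis (Fin (d + 1)) ℝ (Space d × ℝ))
    (T : Fin d → ℝ) : Space d :=
  ∑ i, weights 1 T i • (V i).1

/-- The cumulative weights of the points of an open simplex. -/
def chamber (d : ℕ) : Set (Fin d → ℝ) := {T | ∀ i, 0 < weights 1 T i}

section Adapted

variable {d : ℕ} {B V : Module.Basis (Fin (d + 1)) ℝ (Space d × ℝ)}

lemma det_eq_of_isAdapted (hBV : IsAdapted B V) :
    (stairBasis d).det V = (stairBasis d).det B * ∏ i, B.repr (V i) i := by
  rw [← Module.Basis.det_mul_det (stairBasis d) B V, Module.Basis.det_apply B,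
    Matrix.det_of_isUpperTriangular]
  · rfl
  · intro i j hij
    exact hBV.1 i j hij

lemma flagPoint_lift (hV : IsFrame V) (T : Fin d → ℝ) :
    ((flagPoint V T, 1) : Space d × ℝ) = ∑ i, weights 1 T i • V i := by
  ext1
  · simp [flagPoint, Prod.fst_sum]
  · simp [Prod.snd_sum, hV _, sum_weights]

lemma repr_flagPoint (hV : IsFrame V) (T : Fin d → ℝ) (i : Fin (d + 1)) :
    B.repr (flagPoint V T, 1) i = ∑ j, weights 1 T j * B.repr (V j) i := by
  rw [flagPoint_lift hV, map_sum, Finsupp.finsetSum_apply]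
  simp

lemma cons_pos_of_mem_chamber {T : Fin d → ℝ} (hT : T ∈ chamber d) (i : Fin (d + 1)) :
    0 < (Fin.cons 1 T : Fin (d + 1) → ℝ) i := by
  rw [← sum_Ici_weights]
  exact Finset.sum_pos (fun k _ => hT k) ⟨i, by simp⟩

lemma repr_flagPoint_of_isAdapted (hV : IsFrame V) (hBV : IsAdapted B V) (T : Fin d → ℝ)
    (i : Fin (d + 1)) :
    B.repr (flagPoint V T, 1) i = ∑ j ∈ Finset.Ici i, weights 1 T j * B.repr (V j) i := by
  rw [repr_flagPoint hV]
  symm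
  refine Finset.sum_subset (Finset.subset_univ _) fun j _ hj => ?_
  rw [hBV.1 i j (by simpa using hj), mul_zero]

lemma flagPoint_mem_of_isAdapted (hV : IsFrame V) (hBV : IsAdapted B V) {T : Fin d → ℝ}
    (hT : T ∈ chamber d) : flagPoint V T ∈ openSimplex B := fun i => by
  rw [repr_flagPoint_of_isAdapted hV hBV]
  exact Finset.sum_pos (fun j hj => mul_pos (hT j) (hBV.2 i j (by simpa using hj)))
    ⟨i, by simp⟩

lemma exists_repr_flagPoint_bound (hV : IsFrame V) (hBV : IsAdapted B V) :
    ∃ c > 0, ∀ T ∈ chamber d, ∀ i,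
      c * (Fin.cons 1 T : Fin (d + 1) → ℝ) i ≤ B.repr (flagPoint V T, 1) i := by
  have h1 : ∀ p : Fin (d + 1) × Fin (d + 1), ∃ c > 0, p.1 ≤ p.2 → c ≤ B.repr (V p.2) p.1 := by
    intro p
    by_cases hp : p.1 ≤ p.2
    · exact ⟨_, hBV.2 _ _ hp, fun _ => le_rfl⟩
    · exact ⟨1, one_pos, fun h => absurd h hp⟩
  choose f hf0 hf using h1
  obtain ⟨p, hp⟩ := Finite.exists_min f
  refine ⟨f p, hf0 p, fun T hT i => ?_⟩
  rw [repr_flagPoint_of_isAdapted hV hBV, ← sum_Ici_weights, Finset.mul_sum]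
  refine Finset.sum_le_sum fun j hj => ?_
  rw [mul_comm]
  exact mul_le_mul_of_nonneg_left ((hp (i, j)).trans (hf (i, j) (by simpa using hj))) (hT j).le

lemma density_mul_flagPoint {h : Set (Space d) → Space d → ℝ} (hh : IsVolumeDensity h)
    (hB : IsFrame B) (hV : IsFrame V) (hBV : IsAdapted B V) {T : Fin d → ℝ}
    (hT : T ∈ chamber d) :
    h (openSimplex B) (flagPoint V T) * |(stairBasis d).det V| *
        ∏ i, (Fin.cons 1 T : Fin (d + 1) → ℝ) i =
      simplexConst d h * ∏ i, (B.repr (V i) i /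
        (B.repr (flagPoint V T, 1) i / (Fin.cons 1 T : Fin (d + 1) → ℝ) i)) := by
  have hmem := flagPoint_mem_of_isAdapted hV hBV hT
  rw [← density_openSimplex hh hB hmem, det_eq_of_isAdapted hBV, abs_mul,
    abs_of_pos (Finset.prod_pos fun i _ => hBV.2 i i le_rfl), Finset.prod_div_distrib,
    Finset.prod_div_distrib]
  have h1 : ∏ i, B.repr (flagPoint V T, 1) i ≠ 0 := (Finset.prod_pos fun i _ => hmem i).ne'
  have h2 : ∏ i, (Fin.cons 1 T : Fin (d + 1) → ℝ) i ≠ 0 :=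
    (Finset.prod_pos fun i _ => cons_pos_of_mem_chamber hT i).ne'
  field_simp

lemma exists_density_flagPoint_bound {h : Set (Space d) → Space d → ℝ} (hh : IsVolumeDensity h)
    (hB : IsFrame B) (hV : IsFrame V) (hBV : IsAdapted B V) :
    ∃ K, ∀ T ∈ chamber d, h (openSimplex B) (flagPoint V T) * |(stairBasis d).det V| *
        ∏ i, (Fin.cons 1 T : Fin (d + 1) → ℝ) i ≤ K := by
  obtain ⟨c, hc, hcb⟩ := exists_repr_flagPoint_bound hV hBV
  refine ⟨|simplexConst d h| * ∏ i, (B.repr (V i) i / c), fun T hT => ?_⟩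
  rw [density_mul_flagPoint hh hB hV hBV hT]
  have hpos := cons_pos_of_mem_chamber hT
  have hmem := flagPoint_mem_of_isAdapted hV hBV hT
  refine mul_le_mul (le_abs_self _) ?_ ?_ (abs_nonneg _)
  · refine Finset.prod_le_prod (fun i _ => ?_) fun i _ => ?_
    · exact div_nonneg (hBV.2 i i le_rfl).le (div_nonneg (hmem i).le (hpos i).le)
    · refine div_le_div_of_nonneg_left (hBV.2 i i le_rfl).le hc ?_
      rw [le_div_iff₀ (hpos i)]
      exact hcb T hT i
  · exact Finset.prod_nonneg fun i _ =>
      div_nonneg (hBV.2 i i le_rfl).le (div_nonneg (hmem i).le (hpos i).le)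

/-- Deep inside the flag, where each cumulative weight is negligible compared with the previous
one, the densities of all the simplices that are adapted to the flag are asymptotically equal. -/
lemma tendsto_density_flagPoint {h : Set (Space d) → Space d → ℝ} (hh : IsVolumeDensity h)
    (hB : IsFrame B) (hV : IsFrame V) (hBV : IsAdapted B V) {ι : Type*} {l : Filter ι}
    {T : ι → Fin d → ℝ} (hT : ∀ᶠ r in l, T r ∈ chamber d)
    (hlim : ∀ i, Tendsto (fun r => (Fin.snoc (T r) 0 : Fin (d + 1) → ℝ) i /
      (Fin.cons 1 (T r) : Fin (d + 1) → ℝ) i) l (nhds 0)) :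
    Tendsto (fun r => h (openSimplex B) (flagPoint V (T r)) * |(stairBasis d).det V| *
        ∏ i, (Fin.cons 1 (T r) : Fin (d + 1) → ℝ) i) l (nhds (simplexConst d h)) := by
  have hw : ∀ i j, i ≤ j → Tendsto (fun r => weights 1 (T r) j /
      (Fin.cons 1 (T r) : Fin (d + 1) → ℝ) i) l (nhds (if j = i then 1 else 0)) := by
    intro i j hij
    split_ifs with hji
    · subst hji
      have h1 : Tendsto (fun r => 1 - (Fin.snoc (T r) 0 : Fin (d + 1) → ℝ) j /
          (Fin.cons 1 (T r) : Fin (d + 1) → ℝ) j) l (nhds (1 - 0)) :=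
        tendsto_const_nhds.sub (hlim j)
      rw [sub_zero] at h1
      refine h1.congr' ?_
      filter_upwards [hT] with r hr
      rw [weights, sub_div, div_self (cons_pos_of_mem_chamber hr j).ne']
    · refine squeeze_zero' ?_ ?_ (hlim i)
      · filter_upwards [hT] with r hr
        exact div_nonneg (hr j).le (cons_pos_of_mem_chamber hr i).le
      · filter_upwards [hT] with r hr
        refine div_le_div_of_nonneg_right ?_ (cons_pos_of_mem_chamber hr i).le
        have h2 : weights 1 (T r) i + weights 1 (T r) j ≤
            (Fin.cons 1 (T r) : Fin (d + 1) → ℝ) i := by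
          rw [← sum_Ici_weights, ← Finset.sum_pair (Ne.symm hji)]
          refine Finset.sum_le_sum_of_subset_of_nonneg ?_ fun k _ _ => (hr k).le
          intro k hk
          rcases Finset.mem_insert.1 hk with rfl | hk
          · simp
          · rw [Finset.mem_singleton.1 hk]; simpa using hij
        have h3 : weights 1 (T r) i = (Fin.cons 1 (T r) : Fin (d + 1) → ℝ) i -
          (Fin.snoc (T r) 0 : Fin (d + 1) → ℝ) i := rfl
        linarith
  have hrepr : ∀ i, Tendsto (fun r => B.repr (flagPoint V (T r), 1) i /
      (Fin.cons 1 (T r) : Fin (d + 1) → ℝ) i) l (nhds (B.repr (V i) i)) := by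
    intro i
    have h1 := tendsto_finsetSum (Finset.Ici i) fun j hj =>
      (hw i j (by simpa using hj)).mul_const (B.repr (V j) i)
    have h2 : ∑ j ∈ Finset.Ici i, (if j = i then (1 : ℝ) else 0) * B.repr (V j) i =
        B.repr (V i) i := by simp
    rw [h2] at h1
    refine h1.congr fun r => ?_
    rw [repr_flagPoint_of_isAdapted hV hBV, Finset.sum_div]
    exact Finset.sum_congr rfl fun j _ => by ring
  have h1 : Tendsto (fun r => simplexConst d h * ∏ i, (B.repr (V i) i /
        (B.repr (flagPoint V (T r), 1) i / (Fin.cons 1 (T r) : Fin (d + 1) → ℝ) i))) l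
      (nhds (simplexConst d h * ∏ i, (B.repr (V i) i / B.repr (V i) i))) :=
    tendsto_const_nhds.mul (tendsto_finsetProd _ fun i _ =>
      tendsto_const_nhds.div (hrepr i) (hBV.2 i i le_rfl).ne')
  have h2 : ∏ i, (B.repr (V i) i / B.repr (V i) i) = 1 :=
    Finset.prod_eq_one fun i _ => div_self (hBV.2 i i le_rfl).ne'
  rw [h2, mul_one] at h1
  refine h1.congr' ?_
  filter_upwards [hT] with r hr
  exact (density_mul_flagPoint hh hB hV hBV hr).symm

end Adapted

/-! ### The order of the faces of a polytope -/

/-- Farkas' lemma: a vector that is not a non-negative combination of the `w i` is separated from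
them by a linear functional. -/
lemma farkas {ι E : Type*} [AddCommGroup E] [Module ℝ E] (s : Finset ι) :
    ∀ (w : ι → E) (x : E), (∃ c : ι → ℝ, (∀ i ∈ s, 0 ≤ c i) ∧ x = ∑ i ∈ s, c i • w i) ∨
      ∃ l : E →ₗ[ℝ] ℝ, (∀ i ∈ s, 0 ≤ l (w i)) ∧ l x < 0 := by
  classical
  induction s using Finset.induction_on with
  | empty =>
    intro w x
    by_cases hx : x = 0
    · exact Or.inl ⟨0, by simp, by simp [hx]⟩
    · right
      obtain ⟨l, hl⟩ : ∃ l : Module.Dual ℝ E, l x ≠ 0 := by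
        by_contra! hcon
        exact hx ((Module.forall_dual_apply_eq_zero_iff ℝ x).1 hcon)
      refine ⟨-(l x) • l, by simp, ?_⟩
      simpa using mul_self_pos.2 hl
  | insert k s hk ih =>
    intro w x
    rcases ih w x with ⟨c, hc, hx⟩ | ⟨l, hl, hlx⟩
    · refine Or.inl ⟨Function.update c k 0, fun i hi => ?_, ?_⟩
      · by_cases hik : i = k
        · simp [hik]
        · rw [Function.update_of_ne hik]
          exact hc i (Finset.mem_of_mem_insert_of_ne hi hik)
      · rw [Finset.sum_insert hk, hx]
        simp only [Function.update_self, zero_smul, zero_add]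
        refine Finset.sum_congr rfl fun i hi => ?_
        rw [Function.update_of_ne (ne_of_mem_of_not_mem hi hk)]
    rcases le_or_gt 0 (l (w k)) with h0 | h0
    · refine Or.inr ⟨l, fun i hi => ?_, hlx⟩
      rcases Finset.mem_insert.1 hi with rfl | hi
      exacts [h0, hl i hi]
    -- Project along `w k` to the kernel of `l` and use the induction hypothesis there.
    let π : E →ₗ[ℝ] E := LinearMap.id - (((l (w k))⁻¹ • l).smulRight (w k))
    have hπ : ∀ y, π y = y - ((l (w k))⁻¹ * l y) • w k := fun y => by simp [π]
    rcases ih (fun i => π (w i)) (π x) with ⟨c, hc, hx⟩ | ⟨l', hl', hlx'⟩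
    · left
      have hxx : x = (((l (w k))⁻¹ * l x) - ∑ i ∈ s, c i * ((l (w k))⁻¹ * l (w i))) • w k +
          ∑ i ∈ s, c i • w i := by
        rw [hπ] at hx
        simp only [hπ, smul_sub, Finset.sum_sub_distrib, smul_smul, ← Finset.sum_smul] at hx
        rw [sub_smul]
        refine (eq_add_of_sub_eq hx).trans ?_
        module
      have hinv : (l (w k))⁻¹ < 0 := inv_lt_zero.2 h0
      refine ⟨Function.update c k (((l (w k))⁻¹ * l x) -
        ∑ i ∈ s, c i * ((l (w k))⁻¹ * l (w i))), fun i hi => ?_, ?_⟩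
      · by_cases hik : i = k
        · rw [hik, Function.update_self, sub_nonneg]
          refine le_trans ?_ (mul_pos_of_neg_of_neg hinv hlx).le
          exact Finset.sum_nonpos fun i hi =>
            mul_nonpos_of_nonneg_of_nonpos (hc i hi)
              (mul_nonpos_of_nonpos_of_nonneg hinv.le (hl i hi))
        · rw [Function.update_of_ne hik]
          exact hc i (Finset.mem_of_mem_insert_of_ne hi hik)
      · rw [Finset.sum_insert hk, Function.update_self]
        refine hxx.trans (congrArg _ (Finset.sum_congr rfl fun i hi => ?_))
        rw [Function.update_of_ne (ne_of_mem_of_not_mem hi hk)]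
    · refine Or.inr ⟨l' ∘ₗ π, fun i hi => ?_, hlx'⟩
      rcases Finset.mem_insert.1 hi with rfl | hi
      · simp [hπ, h0.ne]
      · exact hl' i hi

/-- `FaceLE P b a`: the point `b` lies in the smallest closed face of `P` that contains `a`,
because the segment from `b` to `a` can be prolonged inside `P` beyond `a`. -/
def FaceLE {d : ℕ} (P : Set (Space d)) (b a : Space d) : Prop :=
  b ∈ P ∧ ∃ ε : ℝ, 0 < ε ∧ a + ε • (a - b) ∈ P

/-- The (relatively open) face of `P` that contains `a`. -/
def faceOf {d : ℕ} (P : Set (Space d)) (a : Space d) : Set (Space d) := {b ∈ P | FaceRel P a b}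

section Faces

variable {d : ℕ} {P : Set (Space d)} {a b c : Space d}

lemma FaceLE.refl (ha : a ∈ P) : FaceLE P a a := ⟨ha, 1, one_pos, by simpa using ha⟩

lemma FaceLE.exists_le (hP : Convex ℝ P) (ha : a ∈ P) (h : FaceLE P b a) :
    ∃ ε : ℝ, 0 < ε ∧ ∀ δ : ℝ, 0 ≤ δ → δ ≤ ε → a + δ • (a - b) ∈ P := by
  obtain ⟨-, ε, hε, h⟩ := h
  refine ⟨ε, hε, fun δ hδ hδε => ?_⟩
  have h1 : a + δ • (a - b) = (1 - δ / ε) • a + (δ / ε) • (a + ε • (a - b)) := by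
    have : δ = δ / ε * ε := by field_simp
    rw [smul_add, smul_smul, ← this]
    module
  rw [h1]
  exact hP ha h (sub_nonneg.2 ((div_le_one hε).2 hδε)) (by positivity) (by ring)

lemma convex_setOf_faceLE (hP : Convex ℝ P) (ha : a ∈ P) : Convex ℝ {b | FaceLE P b a} := by
  intro x hx y hy s t hs ht hst
  obtain ⟨ε₁, h1, h1'⟩ := FaceLE.exists_le hP ha hx
  obtain ⟨ε₂, h2, h2'⟩ := FaceLE.exists_le hP ha hy
  refine ⟨hP hx.1 hy.1 hs ht hst, min ε₁ ε₂, lt_min h1 h2, ?_⟩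
  have h3 := hP (h1' (min ε₁ ε₂) (lt_min h1 h2).le (min_le_left _ _))
    (h2' (min ε₁ ε₂) (lt_min h1 h2).le (min_le_right _ _)) hs ht hst
  convert h3 using 1
  have : s = 1 - t := by linarith
  subst this
  module

/-- Two points lie in the same face if and only if each lies in the closed face of the other. -/
lemma faceRel_iff (hP : Convex ℝ P) (ha : a ∈ P) (hb : b ∈ P) :
    FaceRel P a b ↔ FaceLE P b a ∧ FaceLE P a b := by
  constructor
  · rintro (rfl | ⟨c, e, hce, hab⟩)
    · exact ⟨FaceLE.refl ha, FaceLE.refl ha⟩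
    have key : ∀ x y, x ∈ P → y ∈ P → x ∈ openSegment ℝ c e → y ∈ openSegment ℝ c e →
        FaceLE P y x := by
      intro x y hx hy hxs hys
      rw [openSegment_eq_image'] at hxs hys
      obtain ⟨α, ⟨hα0, hα1⟩, rfl⟩ := hxs
      obtain ⟨β, ⟨hβ0, hβ1⟩, rfl⟩ := hys
      refine ⟨hy, min α (1 - α), lt_min hα0 (by linarith), hce ?_⟩
      rw [openSegment_eq_image']
      set ε := min α (1 - α)
      have hε : 0 < ε := lt_min hα0 (by linarith)
      have h1 : ε ≤ α := min_le_left _ _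
      have h2 : ε ≤ 1 - α := min_le_right _ _
      refine ⟨α + ε * (α - β), ⟨?_, ?_⟩, ?_⟩
      · nlinarith
      · nlinarith
      · simp only
        module
    exact ⟨key a b ha hb (hab (left_mem_segment ℝ a b)) (hab (right_mem_segment ℝ a b)),
      key b a hb ha (hab (right_mem_segment ℝ a b)) (hab (left_mem_segment ℝ a b))⟩
  · rintro ⟨⟨-, ε₁, h1, h1'⟩, -, ε₂, h2, h2'⟩
    refine Or.inr ⟨a + ε₁ • (a - b), b + ε₂ • (b - a),
      (openSegment_subset_segment ℝ _ _).trans (hP.segment_subset h1' h2'), ?_⟩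
    refine (convex_openSegment _ _).segment_subset ?_ ?_
    · refine ⟨(1 + ε₂) / (1 + ε₁ + ε₂), ε₁ / (1 + ε₁ + ε₂), by positivity, by positivity,
        by field_simp; ring, ?_⟩
      have h3 : 1 + ε₁ + ε₂ ≠ 0 := by positivity
      rw [div_eq_inv_mul, div_eq_inv_mul, mul_smul, mul_smul, ← smul_add,
        inv_smul_eq_iff₀ h3]
      module
    · refine ⟨ε₂ / (1 + ε₁ + ε₂), (1 + ε₁) / (1 + ε₁ + ε₂), by positivity, by positivity,
        by field_simp; ring, ?_⟩
      have h3 : 1 + ε₁ + ε₂ ≠ 0 := by positivity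
      rw [div_eq_inv_mul, div_eq_inv_mul, mul_smul, mul_smul, ← smul_add,
        inv_smul_eq_iff₀ h3]
      module

lemma IsPolytope.convex (hP : IsPolytope P) : Convex ℝ P := by
  obtain ⟨⟨s, rfl⟩, -⟩ := hP
  exact convex_convexHull ℝ _

lemma IsPolytope.isCompact (hP : IsPolytope P) : IsCompact P := by
  obtain ⟨⟨s, rfl⟩, -⟩ := hP
  exact s.finite_toSet.isCompact_convexHull ℝ

lemma mem_faceOf (hP : Convex ℝ P) (ha : a ∈ P) :
    b ∈ faceOf P a ↔ FaceLE P b a ∧ FaceLE P a b := by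
  constructor
  · rintro ⟨hb, h⟩
    exact (faceRel_iff hP ha hb).1 h
  · intro h
    exact ⟨h.1.1, (faceRel_iff hP ha h.1.1).2 h⟩

/-- Every closed face of a polytope is exposed: it is the set where some linear functional is
minimal. -/
lemma exists_exposing (hP : IsPolytope P) (ha : a ∈ P) :
    ∃ l : Space d →ₗ[ℝ] ℝ, ∀ x ∈ P, l a ≤ l x ∧ (l x = l a ↔ FaceLE P x a) := by
  classical
  have hconv := hP.convex
  obtain ⟨⟨s, hs⟩, -⟩ := hP
  have hsP : ∀ v ∈ s, v ∈ P := fun v hv => hs ▸ subset_convexHull ℝ _ hv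
  have h1 : ∀ v, ∃ l : Space d →ₗ[ℝ] ℝ, (∀ w ∈ s, 0 ≤ l (w - a)) ∧
      (v ∈ s → l (v - a) = 0 → FaceLE P v a) := by
    intro v
    -- If `a - v` is a non-negative combination of the `w - a`, then the segment from `v` to `a` can
    -- be prolonged beyond `a`; otherwise Farkas' lemma yields a functional that is positive at `v`.
    rcases farkas s (fun w => w - a) (a - v) with ⟨c, hc, hv⟩ | ⟨l, hl, hlv⟩
    · refine ⟨0, by simp, fun hvs _ => ⟨hsP v hvs, ?_⟩⟩
      have hc0 : 0 ≤ ∑ w ∈ s, c w := Finset.sum_nonneg hc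
      have hpos : 0 < 1 + ∑ w ∈ s, c w := by positivity
      refine ⟨(1 + ∑ w ∈ s, c w)⁻¹, inv_pos.2 hpos, ?_⟩
      have h2 : a + (1 + ∑ w ∈ s, c w)⁻¹ • (a - v) =
          (1 + ∑ w ∈ s, c w)⁻¹ • a + ∑ w ∈ s, ((1 + ∑ w ∈ s, c w)⁻¹ * c w) • w := by
        rw [hv]
        simp only [smul_sub, Finset.sum_sub_distrib, ← Finset.sum_smul, mul_smul,
          ← Finset.smul_sum]
        have h3 : a = (1 + ∑ w ∈ s, c w)⁻¹ • (a + (∑ w ∈ s, c w) • a) := by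
          rw [eq_inv_smul_iff₀ hpos.ne']; module
        conv_lhs => enter [1]; rw [h3]
        module
      rw [h2]
      have h3 := hconv.sum_mem (t := Finset.insertNone s)
        (w := fun o => (1 + ∑ w ∈ s, c w)⁻¹ * (o.elim 1 c)) (z := fun o => o.elim a id)
        (fun o ho => ?_) ?_ (fun o ho => ?_)
      · simpa using h3
      · cases o with
        | none => simpa using inv_nonneg.2 hpos.le
        | some w => exact mul_nonneg (inv_nonneg.2 hpos.le) (hc w (by simpa using ho))
      · rw [← Finset.mul_sum]
        simp [hpos.ne']
      · cases o with
        | none => exact ha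
        | some w => exact hsP w (by simpa using ho)
    · refine ⟨l, hl, fun _ h0 => ?_⟩
      rw [← neg_sub, map_neg, h0] at hlv
      simp at hlv
  choose L hL0 hL using h1
  refine ⟨∑ v ∈ s, L v, ?_⟩
  have hmin : ∀ w ∈ s, 0 ≤ (∑ v ∈ s, L v) (w - a) := fun w hw => by
    rw [LinearMap.sum_apply]
    exact Finset.sum_nonneg fun v _ => hL0 v w hw
  have hle : ∀ x ∈ P, (∑ v ∈ s, L v) a ≤ (∑ v ∈ s, L v) x := by
    intro x hx
    have : P ⊆ {x | (∑ v ∈ s, L v) a ≤ (∑ v ∈ s, L v) x} := by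
      rw [hs]
      refine convexHull_min (fun w hw => ?_)
        (convex_halfSpace_ge (LinearMap.isLinear _) _)
      have := hmin w hw
      rw [map_sub, sub_nonneg] at this
      exact this
    exact this hx
  intro x hx
  refine ⟨hle x hx, fun hxa => ?_, ?_⟩
  · have hx' := hx
    rw [hs, Finset.mem_convexHull'] at hx'
    obtain ⟨μ, hμ0, hμ1, hμx⟩ := hx'
    have h2 : ∑ w ∈ s, μ w * (∑ v ∈ s, L v) (w - a) = 0 := by
      have h3 : x - a = ∑ w ∈ s, μ w • (w - a) := by
        simp only [smul_sub, Finset.sum_sub_distrib, ← Finset.sum_smul, hμ1, hμx, one_smul]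
      have h4 : (∑ v ∈ s, L v) (x - a) = 0 := by rw [map_sub, hxa, sub_self]
      rw [h3, map_sum] at h4
      simpa only [map_smul, smul_eq_mul] using h4
    have h3 : ∀ w ∈ s, μ w ≠ 0 → FaceLE P w a := by
      intro w hw hμw
      have h4 := (Finset.sum_eq_zero_iff_of_nonneg fun w hw =>
        mul_nonneg (hμ0 w hw) (hmin w hw)).1 h2 w hw
      have h5 := (mul_eq_zero.1 h4).resolve_left hμw
      rw [LinearMap.sum_apply] at h5
      exact hL w hw ((Finset.sum_eq_zero_iff_of_nonneg fun v _ => hL0 v w hw).1 h5 w hw)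
    rw [← hμx]
    rw [← Finset.sum_filter_of_ne (p := fun w => μ w ≠ 0)
      (fun w _ hne h0 => hne (by rw [h0, zero_smul]))]
    refine (convex_setOf_faceLE hconv ha).sum_mem (fun w hw => hμ0 w (Finset.mem_filter.1 hw).1)
      ?_ (fun w hw => h3 w (Finset.mem_filter.1 hw).1 (Finset.mem_filter.1 hw).2)
    rw [Finset.sum_filter_of_ne (p := fun w => μ w ≠ 0) (fun w _ hne => hne), hμ1]
  · rintro ⟨-, ε, hε, hmem⟩
    have h2 := hle x hx
    have h3 := hle _ hmem
    rw [map_add, map_smul, map_sub, smul_eq_mul] at h3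
    have h4 : 0 ≤ ε * ((∑ v ∈ s, L v) a - (∑ v ∈ s, L v) x) := by linarith
    have h5 := nonneg_of_mul_nonneg_right h4 hε
    linarith


lemma FaceLE.trans (hP : IsPolytope P) (ha : a ∈ P) (hcb : FaceLE P c b) (hba : FaceLE P b a) :
    FaceLE P c a := by
  obtain ⟨l, hl⟩ := exists_exposing hP ha
  refine (hl c hcb.1).2.1 ?_
  have h1 := (hl b hba.1).2.2 hba
  obtain ⟨hc, ε, hε, hmem⟩ := hcb
  have h2 := (hl c hc).1
  have h3 := (hl _ hmem).1
  rw [map_add, map_smul, map_sub, smul_eq_mul, h1] at h3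
  have h4 : 0 ≤ ε * (l a - l c) := by linarith
  have h5 := nonneg_of_mul_nonneg_right h4 hε
  linarith

/-- A convex combination with positive weights lies in a closed face if and only if all the
points that are combined do. -/
lemma faceLE_sum_iff {ι : Type*} [Fintype ι] (hP : IsPolytope P) (ha : a ∈ P) {t : ι → ℝ}
    {x : ι → Space d} (ht : ∀ i, 0 < t i) (hsum : ∑ i, t i = 1) (hx : ∀ i, x i ∈ P) :
    FaceLE P (∑ i, t i • x i) a ↔ ∀ i, FaceLE P (x i) a := by
  obtain ⟨l, hl⟩ := exists_exposing hP ha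
  have hmem : ∑ i, t i • x i ∈ P :=
    hP.convex.sum_mem (fun i _ => (ht i).le) hsum fun i _ => hx i
  rw [← (hl _ hmem).2]
  have h1 : l (∑ i, t i • x i) - l a = ∑ i, t i * (l (x i) - l a) := by
    simp [mul_sub, Finset.sum_sub_distrib, ← Finset.sum_mul, hsum]
  rw [← sub_eq_zero, h1, Finset.sum_eq_zero_iff_of_nonneg fun i _ =>
    mul_nonneg (ht i).le (sub_nonneg.2 (hl _ (hx i)).1)]
  refine ⟨fun h i => (hl _ (hx i)).2.1 ?_, fun h i _ => ?_⟩
  · have := (mul_eq_zero.1 (h i (Finset.mem_univ i))).resolve_left (ht i).ne'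
    linarith
  · rw [(hl _ (hx i)).2.2 (h i), sub_self, mul_zero]

/-- The special case of two points in `faceLE_sum_iff`. -/
lemma faceLE_combo_iff (hP : IsPolytope P) (ha : a ∈ P) {x y : Space d} {s t : ℝ} (hs : 0 < s)
    (ht : 0 < t) (hst : s + t = 1) (hx : x ∈ P) (hy : y ∈ P) :
    FaceLE P (s • x + t • y) a ↔ FaceLE P x a ∧ FaceLE P y a := by
  have := faceLE_sum_iff (ι := Fin 2) hP ha (t := ![s, t]) (x := ![x, y])
    (by simp [Fin.forall_fin_two, hs, ht]) (by simpa using hst)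
    (by simp [Fin.forall_fin_two, hx, hy])
  simpa [Fin.forall_fin_two] using this

lemma FaceLE.of_mem_interior (ha : a ∈ interior P) (hb : b ∈ P) : FaceLE P b a := by
  refine ⟨hb, ?_⟩
  have h1 : Continuous fun ε : ℝ => a + ε • (a - b) := by fun_prop
  have h2 : ∀ᶠ ε : ℝ in nhds 0, a + ε • (a - b) ∈ P := by
    refine h1.continuousAt.eventually_mem (mem_interior_iff_mem_nhds.1 ?_)
    simpa using ha
  obtain ⟨ε, h3, h4⟩ := ((h2.filter_mono nhdsWithin_le_nhds).and
    (self_mem_nhdsWithin : Set.Ioi (0 : ℝ) ∈ nhdsWithin 0 (Set.Ioi 0))).exists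
  exact ⟨ε, h4, h3⟩

lemma self_mem_faceOf (ha : a ∈ P) : a ∈ faceOf P a := ⟨ha, Or.inl rfl⟩

lemma faceOf_eq_iff (hP : IsPolytope P) (ha : a ∈ P) (hb : b ∈ P) :
    faceOf P a = faceOf P b ↔ FaceLE P a b ∧ FaceLE P b a := by
  constructor
  · intro h
    have : a ∈ faceOf P b := h ▸ self_mem_faceOf ha
    exact (mem_faceOf hP.convex hb).1 this
  · rintro ⟨hab, hba⟩
    ext x
    rw [mem_faceOf hP.convex ha, mem_faceOf hP.convex hb]
    exact ⟨fun h => ⟨h.1.trans hP hb hab, hba.trans hP h.1.1 h.2⟩,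
      fun h => ⟨h.1.trans hP ha hba, hab.trans hP h.1.1 h.2⟩⟩

lemma isFace_faceOf (ha : a ∈ P) : IsFace P (faceOf P a) := ⟨a, ha, rfl⟩

/-- A face of a polytope is determined by the vertices in its closure. -/
lemma finite_setOf_isFace (hP : IsPolytope P) : {F | IsFace P F}.Finite := by
  classical
  have hP' := hP
  obtain ⟨⟨s, hs⟩, -⟩ := hP'
  have hsP : ∀ v ∈ s, v ∈ P := fun v hv => hs ▸ subset_convexHull ℝ _ hv
  have key : ∀ a ∈ P, ∀ b ∈ P, (∀ v ∈ s, FaceLE P v b → FaceLE P v a) → FaceLE P b a := by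
    intro a ha b hb h
    have hb' := hb
    rw [hs, Finset.mem_convexHull'] at hb'
    obtain ⟨μ, hμ0, hμ1, hμb⟩ := hb'
    obtain ⟨l, hl⟩ := exists_exposing hP hb
    have h2 : ∑ w ∈ s, μ w * (l w - l b) = 0 := by
      have : l (∑ w ∈ s, μ w • w) = l b := by rw [hμb]
      rw [map_sum] at this
      simp only [map_smul, smul_eq_mul] at this
      simp only [mul_sub, Finset.sum_sub_distrib, ← Finset.sum_mul, hμ1, this]
      ring
    rw [← hμb, ← Finset.sum_filter_of_ne (p := fun w => μ w ≠ 0)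
      (fun w _ hne h0 => hne (by rw [h0, zero_smul]))]
    refine (convex_setOf_faceLE hP.convex ha).sum_mem
      (fun w hw => hμ0 w (Finset.mem_filter.1 hw).1) ?_ (fun w hw => ?_)
    · rw [Finset.sum_filter_of_ne (p := fun w => μ w ≠ 0) (fun w _ hne => hne), hμ1]
    · obtain ⟨hws, hμw⟩ := Finset.mem_filter.1 hw
      have h3 := (Finset.sum_eq_zero_iff_of_nonneg fun w hw =>
        mul_nonneg (hμ0 w hw) (sub_nonneg.2 (hl w (hsP w hw)).1)).1 h2 w hws
      refine h w hws ((hl w (hsP w hws)).2.1 ?_)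
      linarith [(mul_eq_zero.1 h3).resolve_left hμw]
  refine (Set.Finite.image (fun t : Finset (Space d) =>
    {b ∈ P | s.filter (fun v => FaceLE P v b) = t}) s.powerset.finite_toSet).subset ?_
  rintro F ⟨a, ha, rfl⟩
  refine ⟨s.filter (fun v => FaceLE P v a),
    Finset.mem_coe.2 (Finset.mem_powerset.2 (Finset.filter_subset _ _)), ?_⟩
  ext b
  refine and_congr_right fun hb => ?_
  rw [faceRel_iff hP.convex ha hb]
  constructor
  · intro h
    have h' : ∀ v ∈ s, FaceLE P v b ↔ FaceLE P v a := fun v hv => by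
      have := Finset.ext_iff.1 h v
      simpa [hv] using this
    exact ⟨key a ha b hb fun v hv => (h' v hv).1, key b hb a ha fun v hv => (h' v hv).2⟩
  · rintro ⟨hba, hab⟩
    refine Finset.filter_congr fun v _ => ⟨fun h => h.trans hP ha hba, fun h => h.trans hP hb hab⟩

/-- The dimension of the faces is strictly monotone. -/
lemma affineDim_faceOf_lt (hP : IsPolytope P) (hb : b ∈ P) (hab : FaceLE P a b)
    (hba : ¬ FaceLE P b a) : affineDim (faceOf P a) < affineDim (faceOf P b) := by
  have ha := hab.1
  have hbb : b ∈ affineSpan ℝ (faceOf P b) := subset_affineSpan ℝ _ (self_mem_faceOf hb)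
  have hle : affineSpan ℝ (faceOf P a) ≤ affineSpan ℝ (faceOf P b) := by
    rw [affineSpan_le]
    intro x hx
    have hxb : FaceLE P x b := ((mem_faceOf hP.convex ha).1 hx).1.trans hP hb hab
    have hmid : (2⁻¹ : ℝ) • x + (2⁻¹ : ℝ) • b ∈ P :=
      hP.convex hxb.1 hb (by norm_num) (by norm_num) (by norm_num)
    have hy : (2⁻¹ : ℝ) • x + (2⁻¹ : ℝ) • b ∈ faceOf P b := by
      rw [mem_faceOf hP.convex hb]
      refine ⟨(faceLE_combo_iff hP hb (by norm_num) (by norm_num) (by norm_num) hxb.1 hb).2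
        ⟨hxb, FaceLE.refl hb⟩, ?_⟩
      exact ((faceLE_combo_iff hP hmid (by norm_num) (by norm_num) (by norm_num) hxb.1 hb).1
        (FaceLE.refl hmid)).2
    have h1 := AffineMap.lineMap_mem (2 : ℝ) hbb (subset_affineSpan ℝ _ hy)
    have h2 : AffineMap.lineMap b ((2⁻¹ : ℝ) • x + (2⁻¹ : ℝ) • b) (2 : ℝ) = x := by
      rw [AffineMap.lineMap_apply_module']
      module
    rwa [h2] at h1
  have hlt : affineSpan ℝ (faceOf P a) < affineSpan ℝ (faceOf P b) := by
    refine lt_of_le_of_ne hle fun heq => hba ?_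
    obtain ⟨l, hl⟩ := exists_exposing hP ha
    have h1 : affineSpan ℝ (faceOf P a) ≤
        (AffineSubspace.mk' (l a) (⊥ : Submodule ℝ ℝ)).comap l.toAffineMap := by
      rw [affineSpan_le]
      intro x hx
      have hx' := ((mem_faceOf hP.convex ha).1 hx).1
      simp [AffineSubspace.mem_mk', (hl x hx'.1).2.2 hx']
    have h2 := h1 (heq ▸ hbb)
    refine (hl b hb).2.1 ?_
    simpa [AffineSubspace.mem_mk', sub_eq_zero] using h2
  exact Submodule.finrank_lt_finrank_of_lt (AffineSubspace.direction_lt_of_nonempty hlt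
    ⟨a, subset_affineSpan ℝ _ (self_mem_faceOf ha)⟩)

lemma affineDim_le (F : Set (Space d)) : affineDim F ≤ d := by
  have := Submodule.finrank_le (affineSpan ℝ F).direction
  simpa [affineDim] using this

end Faces

/-! ### Flags and chains of points -/

/-- A chain: points of `P` that lie in the faces of a strictly increasing sequence of faces. -/
def IsFaceChain {d : ℕ} (P : Set (Space d)) {k : ℕ} (v : Fin (k + 1) → Space d) : Prop :=
  (∀ i, v i ∈ P) ∧ ∀ i j, i < j → FaceLE P (v i) (v j) ∧ ¬ FaceLE P (v j) (v i)

section Chains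

variable {d k : ℕ} {P : Set (Space d)} {a b : Space d} {v : Fin (k + 1) → Space d}

lemma IsFaceChain.faceLE (hv : IsFaceChain P v) {i j : Fin (k + 1)} (hij : i ≤ j) :
    FaceLE P (v i) (v j) := by
  rcases hij.eq_or_lt with rfl | h
  · exact FaceLE.refl (hv.1 i)
  · exact (hv.2 i j h).1

lemma isFaceChain_of_succ (hP : IsPolytope P) (hmem : ∀ i, v i ∈ P)
    (h : ∀ i : Fin k, FaceLE P (v i.castSucc) (v i.succ) ∧ ¬ FaceLE P (v i.succ) (v i.castSucc)) :
    IsFaceChain P v := by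
  let r : Space d → Space d → Prop := fun a b => b ∈ P ∧ FaceLE P a b ∧ ¬ FaceLE P b a
  have : IsTrans (Space d) r := ⟨fun a b c hab hbc => ⟨hbc.1, hab.2.1.trans hP hbc.1 hbc.2.1,
    fun hca => hbc.2.2 (hca.trans hP hab.1 hab.2.1)⟩⟩
  refine ⟨hmem, fun i j hij => ?_⟩
  exact ((Fin.liftFun_iff_succ (r := r) (f := v)).2 (fun i => ⟨hmem _, h i⟩) hij).2

lemma IsFaceChain.strictMono_affineDim (hP : IsPolytope P) (hv : IsFaceChain P v) :
    StrictMono fun i => affineDim (faceOf P (v i)) := fun i j hij =>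
  affineDim_faceOf_lt hP (hv.1 j) (hv.2 i j hij).1 (hv.2 i j hij).2

lemma le_of_strictMono_fin {k : ℕ} {D : Fin (k + 1) → ℕ} (hD : StrictMono D) (i : Fin (k + 1)) :
    (i : ℕ) ≤ D i := by
  induction i using Fin.induction with
  | zero => simp
  | succ i ih =>
    have := hD i.castSucc_lt_succ
    simp only [Fin.val_castSucc] at ih
    rw [Fin.val_succ]
    omega

lemma add_le_of_strictMono_fin {k : ℕ} {D : Fin (k + 1) → ℕ} (hD : StrictMono D)
    (i : Fin (k + 1)) : D i + (k - i) ≤ D (Fin.last k) := by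
  induction i using Fin.reverseInduction with
  | last => simp
  | cast i ih =>
    have := hD i.castSucc_lt_succ
    have := i.isLt
    simp only [Fin.val_succ, Fin.val_castSucc] at *
    omega

lemma IsFaceChain.le (hP : IsPolytope P) (hv : IsFaceChain P v) : k ≤ d := by
  have h1 := le_of_strictMono_fin (hv.strictMono_affineDim hP) (Fin.last k)
  exact h1.trans (affineDim_le _)

lemma IsFaceChain.affineDim_eq {v : Fin (d + 1) → Space d} (hP : IsPolytope P)
    (hv : IsFaceChain P v) (i : Fin (d + 1)) : affineDim (faceOf P (v i)) = i := by
  have h1 := le_of_strictMono_fin (hv.strictMono_affineDim hP) i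
  have h2 := add_le_of_strictMono_fin (hv.strictMono_affineDim hP) i
  have h3 := affineDim_le (faceOf P (v (Fin.last d)))
  have h4 := i.isLt
  omega

lemma closure_faceOf_subset (hP : IsPolytope P) (hb : b ∈ P) :
    closure (faceOf P b) ⊆ {a | FaceLE P a b} := by
  obtain ⟨l, hl⟩ := exists_exposing hP hb
  have hcl : IsClosed (P ∩ {x | l x = l b}) :=
    hP.isCompact.isClosed.inter
      (isClosed_eq l.continuous_of_finiteDimensional continuous_const)
  refine (closure_minimal (fun x hx => ?_) hcl).trans fun x hx => (hl x hx.1).2.1 hx.2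
  have := ((mem_faceOf hP.convex hb).1 hx).1
  exact ⟨this.1, (hl x this.1).2.2 this⟩

/-- Points chosen in the faces of a maximal flag form a chain. -/
lemma isFaceChain_of_mem_flags (hP : IsPolytope P) {f : Fin (d + 1) → Set (Space d)}
    (hf : f ∈ flags P) {v : Fin (d + 1) → Space d} (hv : ∀ i, v i ∈ f i) :
    (∀ i, f i = faceOf P (v i)) ∧ IsFaceChain P v := by
  obtain ⟨hface, hdim, hfr⟩ := hf
  have hP' := hP.convex
  have hmem : ∀ i, v i ∈ P := fun i => by
    obtain ⟨a, -, h⟩ := hface i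
    have := hv i
    rw [h] at this
    exact this.1
  have hfv : ∀ i, f i = faceOf P (v i) := fun i => by
    obtain ⟨a, ha, h⟩ := hface i
    have h1 : v i ∈ faceOf P a := by
      have := hv i
      rwa [h] at this
    rw [h]
    exact (faceOf_eq_iff hP ha (hmem i)).2 ((mem_faceOf hP' ha).1 h1).symm
  refine ⟨hfv, isFaceChain_of_succ hP hmem fun i => ?_⟩
  have h1 : FaceLE P (v i.castSucc) (v i.succ) := by
    refine closure_faceOf_subset hP (hmem i.succ) ?_
    rw [← hfv]
    exact intrinsicClosure_subset_closure
      (intrinsicFrontier_subset_intrinsicClosure (hfr i (hv _)))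
  refine ⟨h1, fun h2 => ?_⟩
  have h3 : f i.castSucc = f i.succ := by
    rw [hfv, hfv]
    exact (faceOf_eq_iff hP (hmem _) (hmem _)).2 ⟨h1, h2⟩
  have h4 := hdim i.castSucc
  rw [h3, hdim i.succ] at h4
  simp at h4

/-- The faces that contain the points of a chain of full length form a maximal flag. -/
lemma IsFaceChain.mem_flags {v : Fin (d + 1) → Space d} (hP : IsPolytope P)
    (hv : IsFaceChain P v) : (fun i => faceOf P (v i)) ∈ flags P := by
  refine ⟨fun i => isFace_faceOf (hv.1 i), hv.affineDim_eq hP, fun i x hx => ?_⟩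
  have hb := hv.1 i.succ
  obtain ⟨hlt, hnot⟩ := hv.2 _ _ i.castSucc_lt_succ
  set b := v i.succ
  have hx' := (mem_faceOf hP.convex (hv.1 _)).1 hx
  have hxb : FaceLE P x b := hx'.1.trans hP hb hlt
  rw [← intrinsicClosure_sdiff_intrinsicInterior, intrinsicClosure_eq_closure]
  constructor
  · have h1 : openSegment ℝ x b ⊆ faceOf P b := by
      rintro y ⟨s, t, hs, ht, hst, rfl⟩
      rw [mem_faceOf hP.convex hb]
      have hmem := hP.convex hxb.1 hb hs.le ht.le hst
      exact ⟨(faceLE_combo_iff hP hb hs ht hst hxb.1 hb).2 ⟨hxb, FaceLE.refl hb⟩,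
        ((faceLE_combo_iff hP hmem hs ht hst hxb.1 hb).1 (FaceLE.refl hmem)).2⟩
    exact closure_mono h1 (segment_subset_closure_openSegment (left_mem_segment ℝ x b))
  · intro h
    have h1 := (mem_faceOf hP.convex hb).1 (intrinsicInterior_subset h)
    exact hnot (h1.2.trans hP (hv.1 _) hx'.1)

lemma finite_flags (hP : IsPolytope P) : (flags P).Finite := by
  refine (Set.Finite.pi' fun _ : Fin (d + 1) => finite_setOf_isFace hP).subset ?_
  exact fun f hf i => hf.1 i

open Classical in
/-- A point chosen in the set `F`, which is `p` if possible. -/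
noncomputable def facePoint {d : ℕ} (p : Space d) (F : Set (Space d)) : Space d :=
  if p ∈ F then p else if h : F.Nonempty then h.some else 0

lemma facePoint_mem {p : Space d} {F : Set (Space d)} (hF : F.Nonempty) : facePoint p F ∈ F := by
  unfold facePoint
  split_ifs with h
  · exact h
  · exact hF.some_mem

lemma faceOf_facePoint (hP : IsPolytope P) (p : Space d) (ha : a ∈ P) :
    faceOf P (facePoint p (faceOf P a)) = faceOf P a := by
  have h := facePoint_mem (p := p) ⟨a, self_mem_faceOf ha⟩
  have h' := (mem_faceOf hP.convex ha).1 h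
  exact (faceOf_eq_iff hP h.1 ha).2 h'

lemma IsFace.nonempty {F : Set (Space d)} (hF : IsFace P F) : F.Nonempty := by
  obtain ⟨a, ha, rfl⟩ := hF
  exact ⟨a, self_mem_faceOf ha⟩

/-- The points chosen in the faces of a maximal flag. -/
noncomputable def flagVertex {d : ℕ} (p : Space d) (f : Fin (d + 1) → Set (Space d)) :
    Fin (d + 1) → Space d := fun i => facePoint p (f i)

lemma flagVertex_spec (hP : IsPolytope P) (p : Space d) {f : Fin (d + 1) → Set (Space d)}
    (hf : f ∈ flags P) :
    (∀ i, f i = faceOf P (flagVertex p f i)) ∧ IsFaceChain P (flagVertex p f) :=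
  isFaceChain_of_mem_flags hP hf fun i => facePoint_mem (hf.1 i).nonempty

lemma flagVertex_last (hP : IsPolytope P) {p : Space d} (hp : p ∈ interior P)
    {f : Fin (d + 1) → Set (Space d)} (hf : f ∈ flags P) :
    flagVertex p f (Fin.last d) = p := by
  obtain ⟨hfv, hch⟩ := flagVertex_spec hP p hf
  have hpP := interior_subset hp
  have h1 : FaceLE P (flagVertex p f (Fin.last d)) p := FaceLE.of_mem_interior hp (hch.1 _)
  have h2 : FaceLE P p (flagVertex p f (Fin.last d)) := by
    by_contra hcon
    have h3 := affineDim_faceOf_lt hP hpP h1 hcon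
    rw [hch.affineDim_eq hP] at h3
    have := affineDim_le (faceOf P p)
    simp at h3
    omega
  have h3 : p ∈ f (Fin.last d) := by
    rw [hfv, mem_faceOf hP.convex (hch.1 _)]
    exact ⟨h2, h1⟩
  simp [flagVertex, facePoint, h3]

end Chains

/-! ### The barycentric subdivision of a polytope -/

section Subdivision

variable {d : ℕ} {P : Set (Space d)}

/-- A segment that starts at a point `c` of the face of `x ≠ c` and passes through `x` can be
prolonged until it leaves that face. -/
lemma exists_exit_face (hP : IsPolytope P) {c x : Space d} (hx : x ∈ P) (hcx : FaceLE P c x)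
    (hne : c ≠ x) : ∃ s : ℝ, 0 < s ∧ s < 1 ∧ ∃ y, FaceLE P y x ∧ ¬ FaceLE P x y ∧
      x = s • y + (1 - s) • c := by
  have hcP := hcx.1
  let g : ℝ → Space d := fun t => c + t • (x - c)
  have hg : Continuous g := by fun_prop
  have hn : 0 < ‖x - c‖ := norm_pos_iff.2 (sub_ne_zero.2 hne.symm)
  let S : Set ℝ := Set.Ici 0 ∩ g ⁻¹' P
  have hSc : IsCompact S := by
    refine Metric.isCompact_of_isClosed_isBounded
      (isClosed_Ici.inter (hP.isCompact.isClosed.preimage hg)) ?_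
    obtain ⟨M, hM⟩ := hP.isCompact.isBounded.subset_closedBall c
    refine (Metric.isBounded_Icc (0 : ℝ) (M / ‖x - c‖)).subset fun t ht => ⟨ht.1, ?_⟩
    have h1 := hM ht.2
    rw [mem_closedBall_iff_norm] at h1
    rw [le_div_iff₀ hn]
    simpa [g, norm_smul, abs_of_nonneg (show (0 : ℝ) ≤ t from ht.1)] using h1
  obtain ⟨hcP', ε, hε, hmem⟩ := hcx
  have hεS : 1 + ε ∈ S := by
    refine ⟨by simp; linarith, ?_⟩
    have : g (1 + ε) = x + ε • (x - c) := by simp only [g]; module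
    rw [Set.mem_preimage, this]
    exact hmem
  obtain ⟨t, ht, htmax⟩ := hSc.exists_isGreatest ⟨_, hεS⟩
  have ht1 : 1 < t := by linarith [htmax hεS]
  have ht0 : 0 < t := by linarith
  have hyP : g t ∈ P := ht.2
  have hxy : x = t⁻¹ • g t + (1 - t⁻¹) • c := by
    simp only [g]
    rw [smul_add, smul_smul, inv_mul_cancel₀ ht0.ne']
    module
  have hs1 : t⁻¹ < 1 := inv_lt_one_of_one_lt₀ ht1
  refine ⟨t⁻¹, inv_pos.2 ht0, hs1, g t, ?_, ?_, hxy⟩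
  · have h1 := (faceLE_combo_iff hP hx (inv_pos.2 ht0) (sub_pos.2 hs1) (by ring) hyP hcP).1
      (by rw [← hxy]; exact FaceLE.refl hx)
    exact h1.1
  · rintro ⟨-, δ, hδ, hδP⟩
    have h1 : g t + δ • (g t - x) = g (t + δ * (t - 1)) := by simp only [g]; module
    rw [h1] at hδP
    have h2 : 0 < δ * (t - 1) := mul_pos hδ (by linarith)
    have h3 := htmax (show t + δ * (t - 1) ∈ S from ⟨by simp; linarith, hδP⟩)
    linarith

/-- Every point of a polytope lies in an open simplex spanned by a chain of the chosen points of
the faces. -/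
lemma exists_faceChain (hP : IsPolytope P) (p : Space d) : ∀ n : ℕ, ∀ x ∈ P,
    affineDim (faceOf P x) = n → ∃ (k : ℕ) (v : Fin (k + 1) → Space d) (t : Fin (k + 1) → ℝ),
      IsFaceChain P v ∧ (∀ i, facePoint p (faceOf P (v i)) = v i) ∧ (∀ i, 0 < t i) ∧
        ∑ i, t i = 1 ∧ x = ∑ i, t i • v i := by
  intro n
  induction n using Nat.strong_induction_on with
  | _ n ih =>
  intro x hx hn
  set c := facePoint p (faceOf P x) with hc
  have hcx' : c ∈ faceOf P x := facePoint_mem ⟨x, self_mem_faceOf hx⟩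
  obtain ⟨hcx, hxc⟩ := (mem_faceOf hP.convex hx).1 hcx'
  have hcc : facePoint p (faceOf P c) = c := by
    rw [hc, faceOf_facePoint hP p hx]
  by_cases hne : c = x
  · refine ⟨0, fun _ => c, fun _ => 1, ⟨fun _ => hcx.1, fun i j hij => ?_⟩, fun _ => hcc,
      fun _ => one_pos, by simp, by simp [hne]⟩
    exact absurd (Fin.lt_def.1 hij) (by omega)
  obtain ⟨s, hs0, hs1, y, hyx, hxy, hxs⟩ := exists_exit_face hP hx hcx hne
  obtain ⟨k, v, t, hv, hcan, ht, hsum, hy⟩ :=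
    ih _ (hn ▸ affineDim_faceOf_lt hP hx hyx hxy) y hyx.1 rfl
  have hvy : ∀ i, FaceLE P (v i) y := by
    rw [← faceLE_sum_iff hP hyx.1 ht hsum hv.1, ← hy]
    exact FaceLE.refl hyx.1
  refine ⟨k + 1, Fin.snoc v c, Fin.snoc (fun i => s * t i) (1 - s), ⟨?_, ?_⟩, ?_, ?_, ?_, ?_⟩
  · intro i
    refine Fin.lastCases ?_ (fun i => ?_) i
    · simpa using hcx.1
    · simpa using hv.1 i
  · intro i j
    refine Fin.lastCases ?_ (fun j => ?_) j
    · refine Fin.lastCases ?_ (fun i => ?_) i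
      · intro h; exact absurd h (lt_irrefl _)
      · intro _
        simp only [Fin.snoc_castSucc, Fin.snoc_last]
        exact ⟨((hvy i).trans hP hx hyx).trans hP hcx.1 hxc,
          fun h => hxy ((hxc.trans hP (hv.1 i) h).trans hP hyx.1 (hvy i))⟩
    · refine Fin.lastCases ?_ (fun i => ?_) i
      · intro h; exact absurd h (Fin.castSucc_lt_last j).not_gt
      · intro h
        simpa only [Fin.snoc_castSucc] using hv.2 i j (by simpa using h)
  · intro i
    refine Fin.lastCases ?_ (fun i => ?_) i
    · simpa using hcc
    · simpa using hcan i
  · intro i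
    refine Fin.lastCases ?_ (fun i => ?_) i
    · simpa using hs1
    · simpa using mul_pos hs0 (ht i)
  · simp [Fin.sum_univ_castSucc, ← Finset.mul_sum, hsum]
  · simp only [Fin.sum_univ_castSucc, Fin.snoc_castSucc, Fin.snoc_last, mul_smul,
      ← Finset.smul_sum, ← hy]
    exact hxs

lemma faceChain_weight_le (hP : IsPolytope P) {c y y' x : Space d} {τ τ' : ℝ}
    (hτ1 : τ' < 1) (hc : c ∈ P) (hy : y ∈ P) (hy' : y' ∈ P)
    (hcy : ¬ FaceLE P c y) (h : x = (1 - τ) • y + τ • c) (h' : x = (1 - τ') • y' + τ' • c) :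
    τ' ≤ τ := by
  by_contra! hlt
  have h1 : 0 < 1 - τ := by linarith
  have h2 : y = ((1 - τ') / (1 - τ)) • y' + ((τ' - τ) / (1 - τ)) • c := by
    have h3 : (1 - τ) • y = (1 - τ') • y' + (τ' - τ) • c := by
      rw [h] at h'
      rw [eq_sub_of_add_eq h']
      module
    rw [div_eq_inv_mul, div_eq_inv_mul, mul_smul, mul_smul, ← smul_add, ← h3, smul_smul,
      inv_mul_cancel₀ h1.ne', one_smul]
  have h3 := (faceLE_combo_iff hP hy (div_pos (by linarith : 0 < 1 - τ') h1)
    (div_pos (by linarith : 0 < τ' - τ) h1) (by field_simp; ring) hy' hc).1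
    (by rw [← h2]; exact FaceLE.refl hy)
  exact hcy h3.2

/-- The open simplices of the barycentric subdivision are disjoint. -/
lemma faceChain_unique (hP : IsPolytope P) (p : Space d) : ∀ (k : ℕ)
    (v v' : Fin (k + 1) → Space d) (t t' : Fin (k + 1) → ℝ), IsFaceChain P v →
      IsFaceChain P v' → (∀ i, facePoint p (faceOf P (v i)) = v i) →
      (∀ i, facePoint p (faceOf P (v' i)) = v' i) → (∀ i, 0 < t i) → (∀ i, 0 < t' i) →
      ∑ i, t i = 1 → ∑ i, t' i = 1 → ∑ i, t i • v i = ∑ i, t' i • v' i → v = v' := by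
  intro k
  induction k with
  | zero =>
    intro v v' t t' _ _ _ _ _ _ hs hs' h
    simp at hs hs' h
    ext1 i
    rw [show i = 0 from Fin.ext (by simp)]
    simpa [hs, hs'] using h
  | succ k ih =>
    intro v v' t t' hv hv' hcan hcan' ht ht' hs hs' h
    -- both chains end with the point chosen in the face of the given point
    have htop : ∀ (v : Fin (k + 2) → Space d) (t : Fin (k + 2) → ℝ), IsFaceChain P v →
        (∀ i, facePoint p (faceOf P (v i)) = v i) → (∀ i, 0 < t i) → ∑ i, t i = 1 →
        v (Fin.last _) = facePoint p (faceOf P (∑ i, t i • v i)) := by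
      intro v t hv hcan ht hs
      have hx : ∑ i, t i • v i ∈ P :=
        hP.convex.sum_mem (fun i _ => (ht i).le) hs fun i _ => hv.1 i
      rw [← hcan (Fin.last _), (faceOf_eq_iff hP (hv.1 _) hx).2
        ⟨(faceLE_sum_iff hP hx ht hs hv.1).1 (FaceLE.refl hx) _,
          (faceLE_sum_iff hP (hv.1 _) ht hs hv.1).2 fun i => hv.faceLE (Fin.le_last i)⟩]
    have hlast : v (Fin.last _) = v' (Fin.last _) := by
      rw [htop v t hv hcan ht hs, htop v' t' hv' hcan' ht' hs', h]
    have hsplit : ∀ (v : Fin (k + 2) → Space d) (t : Fin (k + 2) → ℝ), IsFaceChain P v →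
        (∀ i, 0 < t i) → ∑ i, t i = 1 → t (Fin.last _) < 1 ∧
        (∀ i, 0 < t (Fin.castSucc i) / (1 - t (Fin.last _))) ∧
        ∑ i : Fin (k + 1), t (Fin.castSucc i) / (1 - t (Fin.last _)) = 1 ∧
        IsFaceChain P (fun i : Fin (k + 1) => v i.castSucc) ∧
        ∑ i : Fin (k + 1), (t (Fin.castSucc i) / (1 - t (Fin.last _))) • v i.castSucc ∈ P ∧
        ¬ FaceLE P (v (Fin.last _))
          (∑ i : Fin (k + 1), (t (Fin.castSucc i) / (1 - t (Fin.last _))) • v i.castSucc) ∧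
        ∑ i, t i • v i = (1 - t (Fin.last _)) •
          (∑ i : Fin (k + 1), (t (Fin.castSucc i) / (1 - t (Fin.last _))) • v i.castSucc) +
            t (Fin.last _) • v (Fin.last _) := by
      intro v t hv ht hs
      rw [Fin.sum_univ_castSucc] at hs
      have hpos : 0 < ∑ i : Fin (k + 1), t i.castSucc :=
        Finset.sum_pos (fun i _ => ht _) Finset.univ_nonempty
      have h1 : t (Fin.last _) < 1 := by linarith
      have h2 : 0 < 1 - t (Fin.last (k + 1)) := by linarith
      have h3 : ∀ i : Fin (k + 1), 0 < t (Fin.castSucc i) / (1 - t (Fin.last _)) :=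
        fun i => div_pos (ht _) h2
      have h4 : ∑ i : Fin (k + 1), t (Fin.castSucc i) / (1 - t (Fin.last _)) = 1 := by
        rw [← Finset.sum_div, div_eq_one_iff_eq h2.ne']
        linarith
      have h5 : IsFaceChain P (fun i : Fin (k + 1) => v i.castSucc) :=
        ⟨fun i => hv.1 _, fun i j hij => hv.2 _ _ (by simpa using hij)⟩
      have h6 := hP.convex.sum_mem (t := Finset.univ) (fun i _ => (h3 i).le) h4
        fun i _ => hv.1 i.castSucc
      refine ⟨h1, h3, h4, h5, h6, fun hcon => ?_, ?_⟩
      · have h7 := (faceLE_sum_iff hP (hv.1 (Fin.last k).castSucc) h3 h4 fun i => hv.1 _).2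
          fun i => hv.faceLE (Fin.castSucc_le_castSucc_iff.2 (Fin.le_last i))
        exact (hv.2 _ _ (Fin.castSucc_lt_last (Fin.last k))).2
          (hcon.trans hP (hv.1 _) h7)
      · rw [Fin.sum_univ_castSucc, Finset.smul_sum]
        congr 1
        refine Finset.sum_congr rfl fun i _ => ?_
        rw [smul_smul, mul_div_cancel₀ _ h2.ne']
    obtain ⟨h1, h2, h3, h4, h5, h6, h7⟩ := hsplit v t hv ht hs
    obtain ⟨h1', h2', h3', h4', h5', h6', h7'⟩ := hsplit v' t' hv' ht' hs'
    rw [← hlast] at h6' h7'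
    -- if one weight of the common last point were larger, that point would lie in a smaller face
    have hτ : t (Fin.last _) = t' (Fin.last _) := le_antisymm
      (faceChain_weight_le hP h1 (hv.1 _) h5' h5 h6' (h.trans h7') h7)
      (faceChain_weight_le hP h1' (hv.1 _) h5 h5' h6 (h7) (h.trans h7'))
    have hy := h7.symm.trans (h.trans h7')
    rw [← hτ] at hy
    have hy' := smul_right_injective _ (sub_pos.2 h1).ne' (add_right_cancel hy)
    have hinit := ih _ _ _ _ h4 h4' (fun i => hcan _) (fun i => hcan' _) h2 h2' h3 h3'
      (by rw [← hτ] ; exact hy')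
    ext1 i
    refine Fin.lastCases hlast (fun i => ?_) i
    exact congrFun hinit i

end Subdivision

/-! ### Simplices inside and around a polytope, adapted to a flag -/

section InnerOuter

variable {d : ℕ} {P : Set (Space d)} {v : Fin (d + 1) → Space d}

/-- Around a polytope there is a simplex adapted to a given flag; its facets are the supporting
hyperplanes that cut out the faces of the flag, and one more hyperplane. -/
lemma exists_outer_frame (hP : IsPolytope P) (hv : IsFaceChain P v) :
    ∃ V B : Module.Basis (Fin (d + 1)) ℝ (Space d × ℝ), IsFrame V ∧ IsFrame B ∧
      (∀ i, V i = (v i, 1)) ∧ IsAdapted B V ∧ interior P ⊆ openSimplex B := by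
  have hl : ∀ j : Fin d, ∃ l : Space d →ₗ[ℝ] ℝ, ∀ x ∈ P, l (v j.castSucc) ≤ l x ∧
      (l x = l (v j.castSucc) ↔ FaceLE P x (v j.castSucc)) :=
    fun j => exists_exposing hP (hv.1 _)
  choose l hl using hl
  -- The supporting functionals, made homogeneous.
  let n : Fin d → (Space d × ℝ) →ₗ[ℝ] ℝ := fun j =>
    (l j) ∘ₗ LinearMap.fst ℝ _ _ - (l j (v j.castSucc)) • LinearMap.snd ℝ _ _
  have hn : ∀ j x, n j (x, 1) = l j x - l j (v j.castSucc) := fun j x => by simp [n]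
  obtain ⟨K, hK⟩ : ∃ K : ℝ, ∀ x ∈ P, ∑ j, n j (x, 1) ≤ K := by
    have hc : Continuous fun x : Space d => ∑ j, n j (x, 1) :=
      continuous_finsetSum _ fun j _ => (n j).continuous_of_finiteDimensional.comp
        (continuous_id.prodMk continuous_const)
    obtain ⟨K, hK⟩ := (hP.isCompact.image hc).bddAbove
    exact ⟨K, fun x hx => hK ⟨x, hx, rfl⟩⟩
  let N : ℝ := max K 0 + 1
  have hN : 0 < N := by positivity
  have hNK : K < N := by
    have := le_max_left K 0
    simp only [N]
    linarith
  let m : Fin (d + 1) → (Space d × ℝ) →ₗ[ℝ] ℝ :=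
    Fin.cons (LinearMap.snd ℝ _ _ - N⁻¹ • ∑ j, n j) (fun j => N⁻¹ • n j)
  have hm0 : ∀ z, m 0 z = z.2 - N⁻¹ * ∑ j, n j z := fun z => by simp [m]
  have hms : ∀ j z, m (Fin.succ j) z = N⁻¹ * n j z := fun j z => by simp [m]
  have hm0P : ∀ x ∈ P, 0 < m 0 (x, 1) := fun x hx => by
    rw [hm0, sub_pos, inv_mul_lt_iff₀ hN, mul_one]
    exact (hK x hx).trans_lt hNK
  have hmsP : ∀ j, ∀ x ∈ P, ¬ FaceLE P x (v j.castSucc) → 0 < m (Fin.succ j) (x, 1) :=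
    fun j x hx h => by
      rw [hms, hn]
      refine mul_pos (inv_pos.2 hN) (sub_pos.2 (lt_of_le_of_ne (hl j x hx).1 fun heq => ?_))
      exact h ((hl j x hx).2.1 heq.symm)
  have had0 : ∀ i j, j < i → m i (v j, 1) = 0 := by
    intro i j
    refine Fin.cases (fun h => absurd h (Fin.not_lt_zero j)) (fun i h => ?_) i
    rw [hms, hn, ((hl i _ (hv.1 j)).2.2 (hv.faceLE (Fin.le_castSucc_iff.2 h))), sub_self,
      mul_zero]
  have had1 : ∀ i j, i ≤ j → 0 < m i (v j, 1) := by
    intro i j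
    refine Fin.cases (fun _ => hm0P _ (hv.1 j)) (fun i h => ?_) i
    exact hmsP i _ (hv.1 j) (hv.2 _ _ (lt_of_lt_of_le i.castSucc_lt_succ h)).2
  have hdet : (Matrix.of fun i j => m i (v j, 1)).det ≠ 0 := by
    rw [Matrix.det_of_isUpperTriangular]
    · exact Finset.prod_ne_zero_iff.2 fun i _ => (had1 i i le_rfl).ne'
    · intro i j hij
      exact had0 i j hij
  have hindep : ∀ c : Fin (d + 1) → ℝ, (∀ i, m i (∑ j, c j • (v j, (1 : ℝ))) = 0) → c = 0 := by
    intro c hc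
    refine Matrix.eq_zero_of_mulVec_eq_zero hdet ?_
    ext i
    have := hc i
    simp only [map_sum, map_smul, smul_eq_mul] at this
    simp only [Matrix.mulVec, dotProduct, Matrix.of_apply, Pi.zero_apply]
    rw [← this]
    exact Finset.sum_congr rfl fun j _ => mul_comm _ _
  have hli : LinearIndependent ℝ fun j => (v j, (1 : ℝ)) := by
    rw [Fintype.linearIndependent_iff]
    intro c hc i
    rw [hindep c fun i => by rw [hc, map_zero]]
    rfl
  let V := basisOfLinearIndependentOfCardEqFinrank hli (by simp)
  have hV : ∀ i, V i = (v i, 1) := fun i => by simp [V]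
  have hinj : Function.Injective (LinearMap.pi m) := by
    rw [injective_iff_map_eq_zero]
    intro z hz
    have h1 : V.equivFun z = 0 := by
      refine hindep _ fun i => ?_
      have h2 : ∑ j, V.equivFun z j • (v j, (1 : ℝ)) = z := by
        simpa [hV] using V.sum_equivFun z
      rw [h2]
      exact congrFun hz i
    simpa using h1
  let B := Module.Basis.ofEquivFun
    ((LinearMap.pi m).linearEquivOfInjective hinj (by simp))
  have hB : ∀ z i, B.repr z i = m i z := fun z i => by
    simp [B, LinearMap.linearEquivOfInjective_apply]
  have hBf : IsFrame B := by
    intro i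
    have h1 : ∀ z : Space d × ℝ, z.2 = ∑ k, m k z := fun z => by
      rw [Fin.sum_univ_succ, hm0]
      simp_rw [hms, ← Finset.mul_sum]
      ring
    rw [h1]
    simp_rw [← hB]
    simp [Finsupp.single_apply]
  refine ⟨V, B, fun i => by rw [hV], hBf, hV, ⟨fun i j hij => ?_, fun i j hij => ?_⟩, ?_⟩
  · rw [hV, hB, had0 i j hij]
  · rw [hV, hB]; exact had1 i j hij
  · intro x hx i
    rw [hB]
    refine Fin.cases (hm0P x (interior_subset hx)) (fun i => ?_) i
    refine hmsP i x (interior_subset hx) fun h => ?_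
    have hlast := hv.1 (Fin.last d)
    exact (hv.2 _ _ (Fin.castSucc_lt_last i)).2
      ((FaceLE.of_mem_interior hx hlast).trans hP (hv.1 _) h)

/-- Inside a polytope there is a simplex adapted to a given flag; its vertices are obtained by
prolonging the segments between consecutive points of the flag. -/
lemma exists_inner_frame (hP : IsPolytope P) (hv : IsFaceChain P v)
    {V : Module.Basis (Fin (d + 1)) ℝ (Space d × ℝ)} (hV : ∀ i, V i = (v i, 1)) :
    ∃ B : Module.Basis (Fin (d + 1)) ℝ (Space d × ℝ), IsFrame B ∧ IsAdapted B V ∧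
      openSimplex B ⊆ interior P := by
  have hε : ∀ j : Fin d, ∃ ε : ℝ, 0 < ε ∧ v j.succ + ε • (v j.succ - v j.castSucc) ∈ P :=
    fun j => (hv.2 _ _ j.castSucc_lt_succ).1.2
  choose ε hε hmem using hε
  let u : Fin (d + 1) → Space d :=
    Fin.cons (v 0) fun j => v j.succ + ε j • (v j.succ - v j.castSucc)
  have hu0 : u 0 = v 0 := rfl
  have hus : ∀ j : Fin d, u j.succ = v j.succ + ε j • (v j.succ - v j.castSucc) := fun j => rfl
  have huP : ∀ i, u i ∈ P := by
    intro i
    refine Fin.cases ?_ (fun j => ?_) i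
    · rw [hu0]; exact hv.1 0
    · rw [hus]; exact hmem j
  have hls : ∀ j : Fin d, (u j.succ, (1 : ℝ)) = (1 + ε j) • V j.succ - ε j • V j.castSucc := by
    intro j
    rw [hV, hV, hus]
    ext1
    · simp only [Prod.fst_sub, Prod.smul_fst]; module
    · simp
  have hdiag : ∀ i, V.repr (u i, 1) i ≠ 0 ∧ ∀ k, i < k → V.repr (u i, 1) k = 0 := by
    intro i
    refine Fin.cases ?_ (fun j => ?_) i
    · rw [hu0, ← hV]
      simp +contextual [Fin.ne_of_lt]
    · have hj : j.castSucc ≠ j.succ := j.castSucc_lt_succ.ne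
      have hεj := hε j
      rw [hls]
      simp only [map_sub, map_smul, Module.Basis.repr_self, Finsupp.sub_apply,
        Finsupp.smul_apply, Finsupp.single_apply, smul_eq_mul, if_neg hj]
      refine ⟨by simp; linarith, fun k hk => ?_⟩
      rw [if_neg hk.ne, if_neg (j.castSucc_lt_succ.trans hk).ne]
      simp
  have hdet : IsUnit (V.det fun i => (u i, (1 : ℝ))) := by
    rw [Module.Basis.det_apply, Matrix.det_of_isUpperTriangular]
    · exact isUnit_iff_ne_zero.2 (Finset.prod_ne_zero_iff.2 fun i _ => (hdiag i).1)
    · intro i j hij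
      exact (hdiag j).2 i hij
  obtain ⟨hli, hsp⟩ := (V.is_basis_iff_det).2 hdet
  let B := Module.Basis.mk hli hsp.ge
  have hB : ∀ i, B i = (u i, 1) := fun i => by simp [B]
  have hBf : IsFrame B := fun i => by rw [hB]
  refine ⟨B, hBf, ?_, ?_⟩
  · have key : ∀ j i, (j < i → B.repr (V j) i = 0) ∧ (i ≤ j → 0 < B.repr (V j) i) := by
      intro j
      induction j using Fin.induction with
      | zero =>
        intro i
        rw [hV, ← hu0, ← hB, Module.Basis.repr_self]
        refine ⟨fun h => ?_, fun h => ?_⟩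
        · simp [h.ne]
        · simp [Fin.le_zero_iff.1 h]
      | succ j ih =>
        intro i
        have hpos : 0 < 1 + ε j := by linarith [hε j]
        have h1 : V j.succ = (1 + ε j)⁻¹ • (B j.succ + ε j • V j.castSucc) := by
          rw [eq_inv_smul_iff₀ hpos.ne', hB, hls]
          abel
        rw [h1, map_smul, map_add, map_smul, Module.Basis.repr_self]
        simp only [Finsupp.smul_apply, Finsupp.add_apply, smul_eq_mul]
        refine ⟨fun h => ?_, fun h => ?_⟩
        · rw [(ih i).1 (j.castSucc_lt_succ.trans h)]
          simp [h.ne]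
        · refine mul_pos (inv_pos.2 hpos) ?_
          rcases h.eq_or_lt with rfl | h
          · rw [(ih _).1 j.castSucc_lt_succ]
            simp
          · have h2 := (ih i).2 (Fin.le_castSucc_iff.2 h)
            rw [Finsupp.single_eq_of_ne h.ne, zero_add]
            exact mul_pos (hε j) h2
    exact ⟨fun i j => (key j i).1, fun i j => (key j i).2⟩
  · refine interior_maximal (fun x hx => ?_) (isOpen_openSimplex B)
    rw [← show ∑ i, B.repr (x, 1) i • (B i).1 = x from sum_repr_smul_fst (x, 1)]
    refine hP.convex.sum_mem (fun i _ => (hx i).le) (hBf.sum_repr (x, 1)) fun i _ => ?_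
    rw [hB]
    exact huP i

end InnerOuter

/-! ### Logarithmic coordinates on a flag simplex -/

/-- The cumulative weights `exp (-R s)`. -/
noncomputable def expMap {d : ℕ} (R : ℝ) (s : Fin d → ℝ) : Fin d → ℝ :=
  fun j => Real.exp (-(R * s j))

/-- The cone `0 < s 0 < s 1 < ... < s (d - 1)`. -/
def logChamber (d : ℕ) : Set (Fin d → ℝ) :=
  {s | ∀ i : Fin d, (Fin.cons 0 s : Fin (d + 1) → ℝ) i.castSucc < s i}

section LogCoordinates

variable {d : ℕ} {R : ℝ} {s : Fin d → ℝ}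

lemma cons_expMap (R : ℝ) (s : Fin d → ℝ) (i : Fin (d + 1)) :
    (Fin.cons 1 (expMap R s) : Fin (d + 1) → ℝ) i =
      Real.exp (-(R * (Fin.cons 0 s : Fin (d + 1) → ℝ) i)) := by
  refine Fin.cases ?_ (fun j => ?_) i <;> simp [expMap]

lemma prod_cons_expMap (R : ℝ) (s : Fin d → ℝ) :
    ∏ i, (Fin.cons 1 (expMap R s) : Fin (d + 1) → ℝ) i = ∏ j, expMap R s j := by
  simp [Fin.prod_univ_succ]

lemma expMap_mem_chamber_iff (hR : 0 < R) : expMap R s ∈ chamber d ↔ s ∈ logChamber d := by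
  have h1 : ∀ i : Fin d, 0 < weights 1 (expMap R s) i.castSucc ↔
      (Fin.cons 0 s : Fin (d + 1) → ℝ) i.castSucc < s i := by
    intro i
    rw [weights, cons_expMap, Fin.snoc_castSucc, sub_pos, expMap, Real.exp_lt_exp, neg_lt_neg_iff,
      mul_lt_mul_iff_right₀ hR]
  constructor
  · exact fun h i => (h1 i).1 (h i.castSucc)
  · intro h i
    refine Fin.lastCases ?_ (fun i => (h1 i).2 (h i)) i
    rw [weights, cons_expMap, Fin.snoc_last, sub_zero]
    exact Real.exp_pos _

lemma image_expMap (hR : 0 < R) : expMap R '' logChamber d = chamber d := by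
  ext T
  constructor
  · rintro ⟨s, hs, rfl⟩
    exact (expMap_mem_chamber_iff hR).2 hs
  · intro hT
    have hpos : ∀ j, 0 < T j := fun j => by
      simpa using cons_pos_of_mem_chamber hT j.succ
    have h1 : expMap R (fun j => -(Real.log (T j)) / R) = T := by
      ext j
      rw [expMap, mul_div_cancel₀ _ hR.ne', neg_neg, Real.exp_log (hpos j)]
    exact ⟨_, (expMap_mem_chamber_iff hR).1 (by rw [h1]; exact hT), h1⟩

lemma expMap_injective (hR : 0 < R) : Function.Injective (expMap (d := d) R) := by
  intro s s' h
  ext j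
  have h1 := Real.exp_injective (congrFun h j)
  exact mul_left_cancel₀ hR.ne' (neg_injective h1)

lemma continuous_cons (i : Fin (d + 1)) :
    Continuous fun s : Fin d → ℝ => (Fin.cons 0 s : Fin (d + 1) → ℝ) i := by
  refine Fin.cases ?_ (fun j => ?_) i
  · simpa using continuous_const
  · simpa using continuous_apply j

lemma measurableSet_logChamber (d : ℕ) : MeasurableSet (logChamber d) := by
  have : logChamber d =
      ⋂ i : Fin d, {s | (Fin.cons 0 s : Fin (d + 1) → ℝ) i.castSucc < s i} := by
    ext s; simp [logChamber]
  rw [this]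
  exact MeasurableSet.iInter fun i =>
    (isOpen_lt (continuous_cons _) (continuous_apply i)).measurableSet

lemma strictMono_cons_of_mem_logChamber (hs : s ∈ logChamber d) :
    StrictMono (Fin.cons 0 s : Fin (d + 1) → ℝ) :=
  Fin.strictMono_iff_lt_succ.2 fun i => by simpa using hs i

lemma hasFDerivAt_expMap (R : ℝ) (s : Fin d → ℝ) :
    HasFDerivAt (expMap R) (ContinuousLinearMap.pi fun j =>
      (-(R * expMap R s j)) • (ContinuousLinearMap.proj j : (Fin d → ℝ) →L[ℝ] ℝ)) s := by
  rw [hasFDerivAt_pi']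
  intro j
  have h1 : HasFDerivAt (fun s : Fin d → ℝ => s j)
      (ContinuousLinearMap.proj j : (Fin d → ℝ) →L[ℝ] ℝ) s := hasFDerivAt_apply j s
  have h2 := ((h1.const_mul R).neg).exp
  refine h2.congr_fderiv ?_
  ext v
  simp [expMap]
  ring

lemma det_expMap_deriv (R : ℝ) (s : Fin d → ℝ) :
    (ContinuousLinearMap.pi fun j =>
      (-(R * expMap R s j)) • (ContinuousLinearMap.proj j : (Fin d → ℝ) →L[ℝ] ℝ)).det =
      ∏ j, (-(R * expMap R s j)) := by
  have := LinearMap.det_pi (fun j : Fin d =>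
    (-(R * expMap R s j)) • (LinearMap.id : ℝ →ₗ[ℝ] ℝ))
  simp only [LinearMap.det_ring, LinearMap.smul_apply, LinearMap.id_apply, smul_eq_mul,
    mul_one] at this
  rw [← this]
  rfl

variable {V : Module.Basis (Fin (d + 1)) ℝ (Space d × ℝ)}

lemma projMap_frameMap_one (hV : IsFrame V) (y : Space d) :
    frameMap (stairBasis d) V 1 (y, 1) = (flagPoint V y.ofLp, 1) := by
  rw [frameMap_apply, flagPoint_lift hV]
  simp [stairBasis_repr]

/-- Integration over a flag simplex in logarithmic coordinates. -/
lemma lintegral_openSimplex (hV : IsFrame V) (hR : 0 < R) (g : Space d → ℝ≥0∞) :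
    ∫⁻ x in openSimplex V, g x = ENNReal.ofReal (R ^ d) * ∫⁻ s in logChamber d,
      ENNReal.ofReal (|(stairBasis d).det V| * ∏ j, expMap R s j) *
        g (flagPoint V (expMap R s)) := by
  set A := stairBasis d with hAdef
  have hA : IsFrame A := isFrame_stairBasis d
  set L := frameMap A V 1 with hL
  have hLy : ∀ y : Space d, L (y, 1) = (flagPoint V y.ofLp, 1) := projMap_frameMap_one hV
  have hproj : ∀ y : Space d, projMap L y = flagPoint V y.ofLp := fun y => by
    simp [projMap, hLy]
  have himg : projMap L '' openSimplex A = openSimplex V :=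
    image_projMap_frameMap hA hV (by simp)
  have hdet : ∀ y : Space d, (projDeriv L y).det = A.det V := fun y => by
    have := det_projDeriv L (x := y) (by simp [hLy])
    rw [det_frameMap] at this
    simpa [hLy] using this
  have hinj : Set.InjOn (projMap L) (openSimplex A) := by
    intro y _ y' _ h
    rw [hproj, hproj] at h
    have h1 : L (y, 1) = L (y', 1) := by rw [hLy, hLy, h]
    exact congrArg Prod.fst (L.injective h1)
  have hchamber : openSimplex A =
      (MeasurableEquiv.toLp 2 (Fin d → ℝ)).symm ⁻¹' chamber d := by
    ext y
    simp [openSimplex, chamber, hAdef, stairBasis_repr]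
  calc ∫⁻ x in openSimplex V, g x
      = ∫⁻ y in openSimplex A, ENNReal.ofReal |A.det V| * g (flagPoint V y.ofLp) := by
        rw [← himg, lintegral_image_eq_lintegral_abs_det_fderiv_mul volume
          (isOpen_openSimplex A).measurableSet
          (fun y _ => (hasFDerivAt_projMap L (by simp [hLy])).hasFDerivWithinAt) hinj]
        simp_rw [hdet, hproj]
    _ = ∫⁻ T in chamber d, ENNReal.ofReal |A.det V| * g (flagPoint V T) := by
        rw [hchamber]
        exact (EuclideanSpace.volume_preserving_symm_measurableEquiv_toLp
          (Fin d)).setLIntegral_comp_preimage_emb (MeasurableEquiv.measurableEmbedding _)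
          (fun T => ENNReal.ofReal |A.det V| * g (flagPoint V T)) (chamber d)
    _ = ∫⁻ s in logChamber d, ENNReal.ofReal (R ^ d) *
          (ENNReal.ofReal (|A.det V| * ∏ j, expMap R s j) *
            g (flagPoint V (expMap R s))) := by
        rw [← image_expMap hR, lintegral_image_eq_lintegral_abs_det_fderiv_mul volume
          (measurableSet_logChamber d)
          (fun s _ => (hasFDerivAt_expMap R s).hasFDerivWithinAt) (expMap_injective hR).injOn]
        refine lintegral_congr fun s => ?_
        have hpos : 0 ≤ ∏ j, expMap R s j :=
          Finset.prod_nonneg fun j _ => (Real.exp_pos _).le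
        rw [det_expMap_deriv, Finset.abs_prod]
        simp only [abs_neg, abs_mul, abs_of_pos hR, Finset.prod_mul_distrib, Finset.prod_const,
          Finset.card_univ, Fintype.card_fin]
        rw [← Finset.abs_prod, abs_of_nonneg hpos, ← mul_assoc, ← mul_assoc,
          ← ENNReal.ofReal_mul (by positivity), ← ENNReal.ofReal_mul (by positivity)]
        congr 2
        ring
    _ = _ := lintegral_const_mul' _ _ ENNReal.ofReal_ne_top

end LogCoordinates

/-! ### The asymptotic volume of a flag simplex -/

section FlagVolume

variable {d : ℕ} {P : Set (Space d)} {p : Space d}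

lemma IsPolytope.isBoundedConvexDomain (hP : IsPolytope P) :
    IsBoundedConvexDomain (interior P) where
  isOpen := isOpen_interior
  convex := hP.convex.interior
  nonempty := hP.2
  isBounded := hP.isCompact.isBounded.subset interior_subset

lemma gauge_centered_eq_one (hP : IsPolytope P) (hp : p ∈ interior P) {y : Space d} (hy : y ∈ P)
    (hy' : y ∉ interior P) : gauge (centered (interior P) p) (y - p) = 1 := by
  have hΩ := hP.isBoundedConvexDomain
  refine le_antisymm ?_ ?_
  · by_contra! hcon
    set γ := gauge (centered (interior P) p) (y - p)
    have hγ : 0 < γ := by linarith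
    have h1 : p + γ⁻¹ • (y - p) ∈ interior P := by
      have h2 := hP.convex.combo_interior_self_mem_interior hp hy
        (sub_pos.2 (inv_lt_one_of_one_lt₀ hcon)) (inv_pos.2 hγ).le (sub_add_cancel 1 γ⁻¹)
      convert h2 using 1
      module
    rw [← gauge_centered_lt_one_iff hΩ hp, gauge_smul_of_nonneg (inv_pos.2 hγ).le,
      smul_eq_mul, inv_mul_cancel₀ hγ.ne'] at h1
    exact lt_irrefl _ h1
  · rw [← not_lt, gauge_centered_lt_one_iff hΩ hp]
    simpa using hy'

/-- On a flag simplex with last vertex `p`, the gauge is one minus the weight of `p`, because the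
other vertices lie in a common facet. -/
lemma gauge_flagPoint (hP : IsPolytope P) (hp : p ∈ interior P) {v : Fin (d + 1) → Space d}
    (hv : IsFaceChain P v) (hvp : v (Fin.last d) = p)
    {V : Module.Basis (Fin (d + 1)) ℝ (Space d × ℝ)} (hV : ∀ i, V i = (v i, 1)) {T : Fin d → ℝ}
    (hT : T ∈ chamber d) :
    gauge (centered (interior P) p) (flagPoint V T - p) =
      1 - (Fin.cons 1 T : Fin (d + 1) → ℝ) (Fin.last d) := by
  have hlast : weights 1 T (Fin.last d) = (Fin.cons 1 T : Fin (d + 1) → ℝ) (Fin.last d) := by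
    simp [weights]
  have hsum := sum_weights 1 T
  rw [Fin.sum_univ_castSucc] at hsum
  set S := ∑ i : Fin d, weights 1 T i.castSucc with hS
  have hx : flagPoint V T - p = ∑ i : Fin d, weights 1 T i.castSucc • (v i.castSucc - p) := by
    rw [flagPoint, Fin.sum_univ_castSucc]
    simp only [hV, hvp, smul_sub, Finset.sum_sub_distrib, ← Finset.sum_smul]
    rw [← hS, show weights 1 T (Fin.last d) = 1 - S by linarith]
    module
  rw [← hlast, show 1 - weights 1 T (Fin.last d) = S by linarith, hx]
  cases d with
  | zero => simp [hS, gauge_zero]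
  | succ n =>
    have hSpos : 0 < S := Finset.sum_pos (fun i _ => hT _) Finset.univ_nonempty
    have hw : ∀ i : Fin (n + 1), 0 < weights 1 T i.castSucc / S := fun i => div_pos (hT _) hSpos
    have hw1 : ∑ i : Fin (n + 1), weights 1 T i.castSucc / S = 1 := by
      rw [← Finset.sum_div, ← hS, div_self hSpos.ne']
    set y := ∑ i : Fin (n + 1), (weights 1 T i.castSucc / S) • v i.castSucc with hy
    have hyP : y ∈ P := hP.convex.sum_mem (fun i _ => (hw i).le) hw1 fun i _ => hv.1 _
    have hyi : y ∉ interior P := by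
      intro hcon
      have h1 := (faceLE_sum_iff hP (hv.1 (Fin.last n).castSucc) hw hw1 fun i => hv.1 _).2
        fun i => hv.faceLE (Fin.castSucc_le_castSucc_iff.2 (Fin.le_last i))
      exact (hv.2 _ _ (Fin.castSucc_lt_last (Fin.last n))).2
        ((FaceLE.of_mem_interior hcon (hv.1 _)).trans hP (hv.1 _) h1)
    have h2 : ∑ i : Fin (n + 1), weights 1 T i.castSucc • (v i.castSucc - p) = S • (y - p) := by
      rw [hy, smul_sub, Finset.smul_sum]
      simp only [smul_sub, Finset.sum_sub_distrib, ← Finset.sum_smul, ← hS, smul_smul,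
        mul_div_cancel₀ _ hSpos.ne']
    rw [h2, gauge_smul_of_nonneg hSpos.le, gauge_centered_eq_one hP hp hyP hyi, smul_eq_mul,
      mul_one]

lemma IsVolumeDensity.continuousOn {h : Set (Space d) → Space d → ℝ} (hh : IsVolumeDensity h)
    {Ω : Set (Space d)} (hΩ : IsBoundedConvexDomain Ω) : ContinuousOn (h Ω) Ω := by
  rw [Metric.continuousOn_iff]
  intro x hx ε hε
  obtain ⟨δ, hδ, hc⟩ := hh.continuous Ω x hΩ hx ε hε
  refine ⟨δ, hδ, fun y hy hyx => ?_⟩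
  rw [Real.dist_eq]
  exact hc Ω y hΩ hy (by simpa using hδ) hyx

lemma measurable_indicator_density {h : Set (Space d) → Space d → ℝ} (hh : IsVolumeDensity h)
    {Ω : Set (Space d)} (hΩ : IsBoundedConvexDomain Ω) {A : Set (Space d)} (hA : MeasurableSet A)
    (hAΩ : A ⊆ Ω) : Measurable (A.indicator fun x => ENNReal.ofReal (h Ω x)) := by
  classical
  rw [← Set.piecewise_eq_indicator]
  refine ContinuousOn.measurable_piecewise ?_ continuousOn_const hA
  exact ENNReal.continuous_ofReal.comp_continuousOn ((hh.continuousOn hΩ).mono hAΩ)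

/-- The logarithmic coordinates whose last entry is less than `2`; for `d = 0` there is no
condition. -/
def truncatedLogs (d : ℕ) : Set (Fin d → ℝ) :=
  {s | (Fin.cons 0 s : Fin (d + 1) → ℝ) (Fin.last d) < 2}

/-- The asymptotic volume of one flag simplex: a constant times the Lebesgue measure of the set of
all `s` with `0 < s 0 < ... < s (d - 1) < 2`. -/
noncomputable def flagConst (d : ℕ) (h : Set (Space d) → Space d → ℝ) : ℝ≥0∞ :=
  ∫⁻ s in logChamber d,
    (truncatedLogs d).indicator (fun _ => ENNReal.ofReal (simplexConst d h)) s

lemma continuous_flagPoint (V : Module.Basis (Fin (d + 1)) ℝ (Space d × ℝ)) :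
    Continuous (flagPoint V) := by
  have h1 : ∀ i, Continuous fun T : Fin d → ℝ => (Fin.cons 1 T : Fin (d + 1) → ℝ) i := by
    intro i
    refine Fin.cases ?_ (fun j => ?_) i
    · simpa using continuous_const
    · simpa using continuous_apply j
  have h2 : ∀ i, Continuous fun T : Fin d → ℝ => (Fin.snoc T 0 : Fin (d + 1) → ℝ) i := by
    intro i
    refine Fin.lastCases ?_ (fun j => ?_) i
    · simpa using continuous_const
    · simpa using continuous_apply j
  exact continuous_finsetSum _ fun i _ => ((h1 i).sub (h2 i)).smul continuous_const

lemma mem_hilbertBall_flagPoint_iff (hP : IsPolytope P) (hp : p ∈ interior P)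
    {v : Fin (d + 1) → Space d} (hv : IsFaceChain P v) (hvp : v (Fin.last d) = p)
    {V : Module.Basis (Fin (d + 1)) ℝ (Space d × ℝ)} (hV : ∀ i, V i = (v i, 1)) {R : ℝ}
    (hR : 0 < R) {s : Fin d → ℝ} (hs : s ∈ logChamber d)
    (hmem : flagPoint V (expMap R s) ∈ interior P) :
    flagPoint V (expMap R s) ∈ hilbertBall (interior P) p R ↔
      1 + gauge (centered (interior P) p) (p - flagPoint V (expMap R s)) ≤
        Real.exp (R * (2 - (Fin.cons 0 s : Fin (d + 1) → ℝ) (Fin.last d))) := by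
  rw [mem_hilbertBall_iff hP.isBoundedConvexDomain hp, and_iff_right hmem,
    gauge_flagPoint hP hp hv hvp hV ((expMap_mem_chamber_iff hR).2 hs), sub_sub_cancel,
    cons_expMap, ← Real.exp_add]
  ring_nf

lemma tendsto_snoc_div_cons {s : Fin d → ℝ} (hs : s ∈ logChamber d) (i : Fin (d + 1)) :
    Tendsto (fun R => (Fin.snoc (expMap R s) 0 : Fin (d + 1) → ℝ) i /
      (Fin.cons 1 (expMap R s) : Fin (d + 1) → ℝ) i) atTop (nhds 0) := by
  refine Fin.lastCases ?_ (fun i => ?_) i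
  · simp
  · have h1 : 0 < s i - (Fin.cons 0 s : Fin (d + 1) → ℝ) i.castSucc := sub_pos.2 (hs i)
    have h2 : Tendsto (fun R : ℝ => Real.exp (-(R * (s i -
        (Fin.cons 0 s : Fin (d + 1) → ℝ) i.castSucc)))) atTop (nhds 0) :=
      Real.tendsto_exp_neg_atTop_nhds_zero.comp (tendsto_id.atTop_mul_const h1)
    refine h2.congr fun R => ?_
    rw [cons_expMap, Fin.snoc_castSucc, expMap, ← Real.exp_sub]
    ring_nf

lemma volume_setOf_cons_last_eq_two (d : ℕ) :
    volume {s : Fin d → ℝ | (Fin.cons 0 s : Fin (d + 1) → ℝ) (Fin.last d) = 2} = 0 := by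
  cases d with
  | zero => simp
  | succ n =>
    have : {s : Fin (n + 1) → ℝ | (Fin.cons 0 s : Fin (n + 2) → ℝ) (Fin.last (n + 1)) = 2} =
        {s | s (Fin.last n) = 2} := by
      ext s
      rw [← Fin.succ_last]
      simp
    rw [this]
    exact Measure.pi_hyperplane _ _ _

/-- The volume of the part of a ball of radius `R` that lies in a flag simplex is asymptotic to
`flagConst * R ^ d`. -/
lemma tendsto_vol_flagSimplex {h : Set (Space d) → Space d → ℝ} (hh : IsVolumeDensity h)
    (hP : IsPolytope P) (hp : p ∈ interior P) {v : Fin (d + 1) → Space d}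
    (hv : IsFaceChain P v) (hvp : v (Fin.last d) = p)
    {V : Module.Basis (Fin (d + 1)) ℝ (Space d × ℝ)} (hV : ∀ i, V i = (v i, 1)) :
    Tendsto (fun R : ℝ => vol h (interior P) (hilbertBall (interior P) p R ∩ openSimplex V) /
      ENNReal.ofReal (R ^ d)) atTop (nhds (flagConst d h)) := by
  have hΩ := hP.isBoundedConvexDomain
  have hVf : IsFrame V := fun i => by rw [hV]
  obtain ⟨V', B', hV'f, hB'f, hV', hB'V', hout⟩ := exists_outer_frame hP hv
  obtain rfl : V' = V := Module.Basis.eq_of_apply_eq fun i => by rw [hV, hV']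
  obtain ⟨B, hBf, hBV, hin⟩ := exists_inner_frame hP hv hV
  obtain ⟨K, hK⟩ := exists_density_flagPoint_bound hh hBf hVf hBV
  obtain ⟨M, hM⟩ := exists_gauge_centered_bound hΩ hp
  set D := |(stairBasis d).det V'| with hD
  set F : ℝ → (Fin d → ℝ) → ℝ≥0∞ := fun R s => ENNReal.ofReal (D * ∏ j, expMap R s j) *
    (hilbertBall (interior P) p R).indicator (fun x => ENNReal.ofReal (h (interior P) x))
      (flagPoint V' (expMap R s)) with hF
  have hDprod : ∀ R s, 0 ≤ D * ∏ j, expMap (d := d) R s j := fun R s =>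
    mul_nonneg (abs_nonneg _) (Finset.prod_nonneg fun j _ => (Real.exp_pos _).le)
  have hball : ∀ R, MeasurableSet (hilbertBall (interior P) p R) :=
    fun R => measurableSet_hilbertBall hΩ hp R
  have hballΩ : ∀ R, hilbertBall (interior P) p R ⊆ interior P := fun R x hx => hx.1
  -- the volume in logarithmic coordinates
  have hvol : ∀ R > 0, vol h (interior P) (hilbertBall (interior P) p R ∩ openSimplex V') /
      ENNReal.ofReal (R ^ d) = ∫⁻ s in logChamber d, F R s := by
    intro R hR
    rw [vol, ← Measure.restrict_restrict (hball R), ← lintegral_indicator (hball R),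
      lintegral_openSimplex hVf hR, mul_comm, ENNReal.mul_div_cancel_right]
    · simpa using pow_pos hR d
    · exact ENNReal.ofReal_ne_top
  have hmemΩ : ∀ R > 0, ∀ s ∈ logChamber d, flagPoint V' (expMap R s) ∈ interior P :=
    fun R hR s hs => hin (flagPoint_mem_of_isAdapted hVf hBV ((expMap_mem_chamber_iff hR).2 hs))
  -- comparison with the densities of the inner and the outer simplex
  have hupper : ∀ R > 0, ∀ s ∈ logChamber d, D * (∏ j, expMap R s j) *
      h (interior P) (flagPoint V' (expMap R s)) ≤
      h (openSimplex B) (flagPoint V' (expMap R s)) * D *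
        ∏ i, (Fin.cons 1 (expMap R s) : Fin (d + 1) → ℝ) i := by
    intro R hR s hs
    rw [prod_cons_expMap, mul_assoc _ D, mul_comm]
    exact mul_le_mul_of_nonneg_right (hh.anti _ _ _ hBf.isBoundedConvexDomain hΩ hin
      (flagPoint_mem_of_isAdapted hVf hBV ((expMap_mem_chamber_iff hR).2 hs))) (hDprod R s)
  have hlower : ∀ R > 0, ∀ s ∈ logChamber d, h (openSimplex B') (flagPoint V' (expMap R s)) * D *
        ∏ i, (Fin.cons 1 (expMap R s) : Fin (d + 1) → ℝ) i ≤ D * (∏ j, expMap R s j) *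
      h (interior P) (flagPoint V' (expMap R s)) := by
    intro R hR s hs
    rw [prod_cons_expMap, mul_assoc _ D, mul_comm]
    exact mul_le_mul_of_nonneg_left (hh.anti _ _ _ hΩ hB'f.isBoundedConvexDomain hout
      (hmemΩ R hR s hs)) (hDprod R s)
  have hFmeas : ∀ R, Measurable (F R) := by
    intro R
    have h1 : Measurable (expMap (d := d) R) := by
      refine measurable_pi_lambda _ fun j => ?_
      exact (Real.measurable_exp.comp ((measurable_const.mul (measurable_pi_apply j)).neg))
    have h2 : Measurable (flagPoint V') := (continuous_flagPoint V').measurable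
    refine Measurable.mul (ENNReal.measurable_ofReal.comp (measurable_const.mul
      (Finset.measurable_fun_prod _ fun j _ => (measurable_pi_apply j).comp h1))) ?_
    exact (measurable_indicator_density hh hΩ (hball R) (hballΩ R)).comp (h2.comp h1)
  have hkey : Tendsto (fun R => ∫⁻ s in logChamber d, F R s) atTop (nhds (flagConst d h)) := by
    refine tendsto_lintegral_filter_of_dominated_convergence
      ((Set.Icc (0 : Fin d → ℝ) 2).indicator fun _ => ENNReal.ofReal K)
      (Eventually.of_forall hFmeas) ?_ ?_ ?_
    · filter_upwards [eventually_gt_atTop 0] with R hR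
      filter_upwards [ae_restrict_mem (measurableSet_logChamber d)] with s hs
      by_cases hb : flagPoint V' (expMap R s) ∈ hilbertBall (interior P) p R
      · -- in the ball the last coordinate, and hence every coordinate, is at most `2`
        have hs2 : (Fin.cons 0 s : Fin (d + 1) → ℝ) (Fin.last d) ≤ 2 := by
          have h1 := (mem_hilbertBall_flagPoint_iff hP hp hv hvp hV hR hs
            (hmemΩ R hR s hs)).1 hb
          have h2 : 1 ≤ Real.exp (R * (2 - (Fin.cons 0 s : Fin (d + 1) → ℝ) (Fin.last d))) :=
            le_trans (le_add_of_nonneg_right (gauge_nonneg _)) h1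
          rw [Real.one_le_exp_iff] at h2
          have h3 := nonneg_of_mul_nonneg_right h2 hR
          linarith
        have hmono := (strictMono_cons_of_mem_logChamber hs).monotone
        have hsI : s ∈ Set.Icc (0 : Fin d → ℝ) 2 := by
          refine ⟨fun j => ?_, fun j => ?_⟩
          · simpa using hmono (Fin.zero_le j.succ)
          · have h1 := hmono (Fin.le_last j.succ)
            rw [Fin.cons_succ] at h1
            exact h1.trans hs2
        rw [Set.indicator_of_mem hsI, hF]
        simp only
        rw [Set.indicator_of_mem hb, ← ENNReal.ofReal_mul (hDprod R s)]
        exact ENNReal.ofReal_le_ofReal ((hupper R hR s hs).trans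
          (hK _ ((expMap_mem_chamber_iff hR).2 hs)))
      · rw [hF]
        simp only
        rw [Set.indicator_of_notMem hb, mul_zero]
        exact zero_le
    · rw [lintegral_indicator measurableSet_Icc, lintegral_const]
      refine ENNReal.mul_ne_top ENNReal.ofReal_ne_top ?_
      rw [Measure.restrict_apply_univ]
      exact ((Measure.restrict_apply_le _ _).trans_lt isCompact_Icc.measure_lt_top).ne
    · have hae : ∀ᵐ s : Fin d → ℝ, (Fin.cons 0 s : Fin (d + 1) → ℝ) (Fin.last d) ≠ 2 :=
        measure_eq_zero_iff_ae_notMem.1 (volume_setOf_cons_last_eq_two d)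
      filter_upwards [ae_restrict_mem (measurableSet_logChamber d), ae_restrict_of_ae hae]
        with s hs hs2
      rcases lt_or_gt_of_ne hs2 with hlt | hgt
      · rw [Set.indicator_of_mem (show s ∈ truncatedLogs d from hlt)]
        have hT : ∀ᶠ R : ℝ in atTop, expMap R s ∈ chamber d := by
          filter_upwards [eventually_gt_atTop 0] with R hR
          exact (expMap_mem_chamber_iff hR).2 hs
        have h1 : Tendsto (fun R => D * (∏ j, expMap R s j) *
            h (interior P) (flagPoint V' (expMap R s))) atTop (nhds (simplexConst d h)) := by
          refine tendsto_of_tendsto_of_tendsto_of_le_of_le'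
            (tendsto_density_flagPoint hh hB'f hVf hB'V' hT (tendsto_snoc_div_cons hs))
            (tendsto_density_flagPoint hh hBf hVf hBV hT (tendsto_snoc_div_cons hs)) ?_ ?_
          · filter_upwards [eventually_gt_atTop 0] with R hR using hlower R hR s hs
          · filter_upwards [eventually_gt_atTop 0] with R hR using hupper R hR s hs
        refine (ENNReal.tendsto_ofReal h1).congr' ?_
        have h2 : Tendsto (fun R : ℝ => Real.exp (R * (2 -
            (Fin.cons 0 s : Fin (d + 1) → ℝ) (Fin.last d)))) atTop atTop :=
          Real.tendsto_exp_atTop.comp (tendsto_id.atTop_mul_const (sub_pos.2 hlt))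
        filter_upwards [eventually_gt_atTop 0, h2.eventually_ge_atTop (1 + M)] with R hR hRM
        have hb : flagPoint V' (expMap R s) ∈ hilbertBall (interior P) p R :=
          (mem_hilbertBall_flagPoint_iff hP hp hv hvp hV hR hs (hmemΩ R hR s hs)).2
            ((add_le_add_right (hM _ (hmemΩ R hR s hs)) _).trans hRM)
        rw [hF]
        simp only
        rw [Set.indicator_of_mem hb, ENNReal.ofReal_mul (hDprod R s)]
      · rw [Set.indicator_of_notMem (show s ∉ truncatedLogs d from not_lt.2 hgt.le)]
        refine tendsto_const_nhds.congr' ?_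
        filter_upwards [eventually_gt_atTop 0] with R hR
        have hb : flagPoint V' (expMap R s) ∉ hilbertBall (interior P) p R := by
          rw [mem_hilbertBall_flagPoint_iff hP hp hv hvp hV hR hs (hmemΩ R hR s hs), not_le]
          refine lt_of_lt_of_le (Real.exp_lt_one_iff.2 (mul_neg_of_pos_of_neg hR (by linarith))) ?_
          exact le_add_of_nonneg_right (gauge_nonneg _)
        rw [hF]
        simp only
        rw [Set.indicator_of_notMem hb, mul_zero]
  refine hkey.congr' ?_
  filter_upwards [eventually_gt_atTop 0] with R hR using (hvol R hR).symm

end FlagVolume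

/-! ### The asymptotic volume of a polytope -/

section PolytopeVolume

variable {d : ℕ} {P : Set (Space d)} {p : Space d}

/-- The affine subspaces spanned by at most `d` of finitely many given points form a null set. -/
lemma volume_iUnion_affineSpan_eq_zero {Z : Set (Space d)} (hZ : Z.Finite) :
    volume (⋃ (k : Fin d) (v : Fin (k + 1) → Z),
      (affineSpan ℝ (Set.range fun i => (v i : Space d)) : Set (Space d))) = 0 := by
  have := hZ.countable.to_subtype
  refine measure_iUnion_null fun k => measure_iUnion_null fun v => ?_
  refine Measure.addHaar_affineSubspace _ _ fun htop => ?_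
  have h1 := finrank_vectorSpan_range_le ℝ (fun i => (v i : Space d)) (n := k) (by simp)
  rw [← direction_affineSpan, htop, AffineSubspace.direction_top, finrank_top] at h1
  have := k.isLt
  simp at h1
  omega

lemma mem_openSimplex_of_eq_sum {v : Fin (d + 1) → Space d}
    {V : Module.Basis (Fin (d + 1)) ℝ (Space d × ℝ)} (hV : ∀ i, V i = (v i, 1))
    {t : Fin (d + 1) → ℝ} (ht : ∀ i, 0 < t i) (hsum : ∑ i, t i = 1) {x : Space d}
    (hx : x = ∑ i, t i • v i) : x ∈ openSimplex V := by
  have h1 : ((x, 1) : Space d × ℝ) = ∑ i, t i • V i := by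
    ext1
    · simp [Prod.fst_sum, hV, hx]
    · simp [Prod.snd_sum, hV, hsum]
  intro i
  rw [h1, map_sum, Finsupp.finsetSum_apply]
  simpa [Finsupp.single_apply] using ht i

/-- Up to a null set, the interior of a polytope is the disjoint union of its flag simplices. -/
lemma flagSimplices_partition (hP : IsPolytope P) (p : Space d)
    {V : flags P → Module.Basis (Fin (d + 1)) ℝ (Space d × ℝ)}
    (hV : ∀ f i, V f i = (flagVertex p f.1 i, 1)) :
    Pairwise (Function.onFun Disjoint fun f => openSimplex (V f)) ∧
      volume (P \ ⋃ f, openSimplex (V f)) = 0 := by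
  constructor
  · intro f g hfg
    rw [Function.onFun, Set.disjoint_left]
    intro x hxf hxg
    refine hfg (Subtype.ext ?_)
    obtain ⟨hf1, hf2⟩ := flagVertex_spec hP p f.2
    obtain ⟨hg1, hg2⟩ := flagVertex_spec hP p g.2
    have hVf : ∀ f, IsFrame (V f) := fun f i => by rw [hV]
    have hx : ∀ f, ∑ i, (V f).repr (x, 1) i • flagVertex p f.1 i = x := fun f => by
      simpa only [hV] using sum_repr_smul_fst (B := V f) (x, 1)
    have h1 := faceChain_unique hP p d _ _ _ _ hf2 hg2
      (fun i => by rw [← hf1]; rfl) (fun i => by rw [← hg1]; rfl) hxf hxg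
      ((hVf f).sum_repr (x, 1)) ((hVf g).sum_repr (x, 1)) ((hx f).trans (hx g).symm)
    ext1 i
    rw [hf1, hg1, h1]
  · have hZ : (facePoint p '' {F | IsFace P F}).Finite := (finite_setOf_isFace hP).image _
    refine measure_mono_null ?_ (volume_iUnion_affineSpan_eq_zero hZ)
    rintro x ⟨hx, hx'⟩
    obtain ⟨k, v, t, hv, hcan, ht, hsum, hxs⟩ := exists_faceChain hP p _ x hx rfl
    have hvZ : ∀ i, v i ∈ facePoint p '' {F | IsFace P F} :=
      fun i => ⟨faceOf P (v i), isFace_faceOf (hv.1 i), hcan i⟩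
    rcases (hv.le hP).eq_or_lt with rfl | hk
    · refine absurd (Set.mem_iUnion.2 ⟨⟨_, hv.mem_flags hP⟩, ?_⟩) hx'
      exact mem_openSimplex_of_eq_sum (hV _) ht hsum (by simp [flagVertex, hcan, hxs])
    · refine Set.mem_iUnion₂.2 ⟨⟨k, hk⟩, fun i => ⟨v i, hvZ i⟩, ?_⟩
      refine convexHull_subset_affineSpan _ ?_
      rw [hxs]
      exact (convex_convexHull ℝ _).sum_mem (fun i _ => (ht i).le) hsum
        fun i _ => subset_convexHull ℝ _ ⟨i, rfl⟩

/-- Every maximal flag contributes the same amount to the asymptotic volume of a polytope. -/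
lemma asvol_interior_eq {h : Set (Space d) → Space d → ℝ} (hh : IsVolumeDensity h)
    (hP : IsPolytope P) (hp : p ∈ interior P) :
    asvol h (interior P) p = ((flags P).encard : ℝ≥0∞) * flagConst d h := by
  have hex : ∀ f : flags P, ∃ V : Module.Basis (Fin (d + 1)) ℝ (Space d × ℝ),
      ∀ i, V i = (flagVertex p f.1 i, 1) := fun f => by
    obtain ⟨V, B, -, -, hV, -⟩ := exists_outer_frame hP (flagVertex_spec hP p f.2).2
    exact ⟨V, hV⟩
  choose V hV using hex
  obtain ⟨hdisj, hnull⟩ := flagSimplices_partition hP p hV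
  have := (finite_flags hP).fintype
  have hball : ∀ R, MeasurableSet (hilbertBall (interior P) p R) :=
    fun R => measurableSet_hilbertBall hP.isBoundedConvexDomain hp R
  have hsplit : ∀ R, vol h (interior P) (hilbertBall (interior P) p R) =
      ∑ f, vol h (interior P) (hilbertBall (interior P) p R ∩ openSimplex (V f)) := by
    intro R
    have hae : hilbertBall (interior P) p R =ᵐ[volume]
        ⋃ f, hilbertBall (interior P) p R ∩ openSimplex (V f) := by
      rw [← Set.inter_iUnion]
      refine (ae_eq_set.2 ⟨measure_mono_null ?_ hnull, ?_⟩)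
      · rintro x ⟨hx, hx'⟩
        exact ⟨interior_subset hx.1, fun hxU => hx' ⟨hx, hxU⟩⟩
      · rw [Set.sdiff_eq_empty.2 Set.inter_subset_left, measure_empty]
    rw [vol, setLIntegral_congr hae, lintegral_iUnion, tsum_fintype]
    · rfl
    · exact fun f => (hball R).inter (isOpen_openSimplex (V f)).measurableSet
    · exact fun f g hfg => (hdisj hfg).mono Set.inter_subset_right Set.inter_subset_right
  have hlim : Tendsto (fun R : ℝ => vol h (interior P) (hilbertBall (interior P) p R) /
      ENNReal.ofReal (R ^ d)) atTop (nhds (∑ _f : flags P, flagConst d h)) := by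
    have h1 := tendsto_finsetSum Finset.univ fun (f : flags P) _ =>
      tendsto_vol_flagSimplex hh hP hp (flagVertex_spec hP p f.2).2 (flagVertex_last hP hp f.2)
        (hV f)
    refine h1.congr fun R => ?_
    rw [hsplit R, ENNReal.div_eq_inv_mul, Finset.mul_sum]
    exact Finset.sum_congr rfl fun f _ => ENNReal.div_eq_inv_mul
  rw [asvol, hlim.liminf_eq, Finset.sum_const, nsmul_eq_mul, Finset.card_univ,
    Set.encard_eq_coe_toFinset_card, Set.toFinset_card]
  rfl

end PolytopeVolume

/-! ### The flags of a simplex -/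

section SimplexFlags

variable {d : ℕ}

lemma IsSimplex.exists_affineBasis {S : Set (Space d)} (hS : IsSimplex S) :
    ∃ b : AffineBasis (Fin (d + 1)) ℝ (Space d), S = convexHull ℝ (Set.range b) := by
  obtain ⟨v, hv, rfl⟩ := hS
  exact ⟨⟨v, hv, hv.affineSpan_eq_top_iff_card_eq_finrank_add_one.2 (by simp)⟩, rfl⟩

lemma IsSimplex.isPolytope {S : Set (Space d)} (hS : IsSimplex S) : IsPolytope S := by
  classical
  obtain ⟨b, rfl⟩ := hS.exists_affineBasis
  refine ⟨⟨Finset.univ.image b, by simp⟩, ?_⟩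
  exact interior_convexHull_nonempty_iff_affineSpan_eq_top.2 b.tot

variable (b : AffineBasis (Fin (d + 1)) ℝ (Space d))

lemma mem_simplex_iff {x : Space d} :
    x ∈ convexHull ℝ (Set.range b) ↔ ∀ i, 0 ≤ b.coord i x := by
  rw [b.convexHull_eq_nonneg_coord]; rfl

/-- The closed faces of a simplex correspond to the sets of vertices. -/
lemma faceLE_simplex_iff {x a : Space d} (hx : x ∈ convexHull ℝ (Set.range b))
    (ha : a ∈ convexHull ℝ (Set.range b)) :
    FaceLE (convexHull ℝ (Set.range b)) x a ↔ ∀ i, b.coord i a = 0 → b.coord i x = 0 := by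
  have hline : ∀ (ε : ℝ) i, b.coord i (a + ε • (a - x)) =
      b.coord i a + ε * (b.coord i a - b.coord i x) := by
    intro ε i
    have h1 : a + ε • (a - x) = AffineMap.lineMap a x (-ε) := by
      rw [AffineMap.lineMap_apply_module']; module
    rw [h1, AffineMap.apply_lineMap, AffineMap.lineMap_apply_module']
    simp only [smul_eq_mul]
    ring
  have hx0 := (mem_simplex_iff b).1 hx
  have ha0 := (mem_simplex_iff b).1 ha
  constructor
  · rintro ⟨-, ε, hε, hmem⟩ i hi
    have h1 := (mem_simplex_iff b).1 hmem i
    rw [hline, hi] at h1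
    have h2 := hx0 i
    nlinarith
  · intro h
    let f : Fin (d + 1) → ℝ := fun i => if b.coord i a = 0 then 1 else b.coord i a
    have hf : ∀ i, 0 < f i := fun i => by
      simp only [f]
      split_ifs with h0
      · exact one_pos
      · exact lt_of_le_of_ne (ha0 i) (Ne.symm h0)
    obtain ⟨k, hk⟩ := Finite.exists_min f
    refine ⟨hx, f k, hf k, (mem_simplex_iff b).2 fun i => ?_⟩
    rw [hline]
    by_cases h0 : b.coord i a = 0
    · simp [h0, h i h0]
    · have h1 : f k ≤ b.coord i a := by simpa [f, h0] using hk i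
      have h2 : b.coord i x ≤ 1 := by
        rw [← b.sum_coord_apply_eq_one x]
        exact Finset.single_le_sum (fun j _ => hx0 j) (Finset.mem_univ i)
      have h3 := hf k
      nlinarith [ha0 i, hx0 i]

/-- A point of the simplex with a given set of positive barycentric coordinates. -/
lemma exists_coord_eq_zero_iff {I : Finset (Fin (d + 1))} (hI : I.Nonempty) :
    ∃ x ∈ convexHull ℝ (Set.range b), ∀ i, b.coord i x = 0 ↔ i ∉ I := by
  let w : Fin (d + 1) → ℝ := fun i => if i ∈ I then (I.card : ℝ)⁻¹ else 0
  have hc : (0 : ℝ) < I.card := by exact_mod_cast hI.card_pos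
  have hw : ∑ i, w i = 1 := by
    simp [w, hc.ne']
  have hcoord : ∀ i, b.coord i (Finset.univ.affineCombination ℝ b w) = w i := fun i =>
    b.coord_apply_combination_of_mem (Finset.mem_univ i) hw
  refine ⟨Finset.univ.affineCombination ℝ b w, (mem_simplex_iff b).2 fun i => ?_, fun i => ?_⟩
  · rw [hcoord]
    simp only [w]
    split_ifs <;> positivity
  · rw [hcoord]
    simp only [w]
    split_ifs with h <;> simp [h, hc.ne']

/-- The maximal flags of a simplex correspond to the orders of its vertices. -/
lemma encard_flags_simplex (hP : IsPolytope (convexHull ℝ (Set.range b))) :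
    (flags (convexHull ℝ (Set.range b))).encard = (d + 1)! := by
  classical
  set S := convexHull ℝ (Set.range b) with hS
  -- a point in the open face spanned by the first `i + 1` vertices in the order `σ`
  have hex : ∀ (σ : Equiv.Perm (Fin (d + 1))) (i : Fin (d + 1)), ∃ x ∈ S,
      ∀ k, b.coord k x = 0 ↔ ¬ σ.symm k ≤ i := by
    intro σ i
    obtain ⟨x, hx, hxk⟩ := exists_coord_eq_zero_iff b
      (I := Finset.univ.filter fun k => σ.symm k ≤ i) ⟨σ i, by simp⟩
    exact ⟨x, hx, fun k => by simpa using hxk k⟩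
  choose x hxS hx using hex
  have hchain : ∀ σ, IsFaceChain S (x σ) := by
    refine fun σ => ⟨hxS σ, fun i j hij => ?_⟩
    rw [faceLE_simplex_iff b (hxS σ i) (hxS σ j), faceLE_simplex_iff b (hxS σ j) (hxS σ i)]
    refine ⟨fun k hk => (hx σ i k).2 fun h => (hx σ j k).1 hk (h.trans hij.le), fun hcon => ?_⟩
    have h1 := hcon (σ j) ((hx σ i _).2 (by simpa using hij))
    exact (hx σ j _).1 h1 (by simp)
  have hinj : Function.Injective fun σ i => faceOf S (x σ i) := by
    intro σ τ h
    have key : ∀ σ τ : Equiv.Perm (Fin (d + 1)),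
        (fun i => faceOf S (x σ i)) = (fun i => faceOf S (x τ i)) →
        ∀ k, σ.symm k ≤ τ.symm k := by
      intro σ τ h k
      by_contra hcon
      have h1 := (faceOf_eq_iff hP (hxS σ _) (hxS τ _)).1 (congrFun h (τ.symm k))
      rw [faceLE_simplex_iff b (hxS τ _) (hxS σ _)] at h1
      exact (hx τ _ k).1 (h1.2 k ((hx σ _ k).2 hcon)) le_rfl
    have h2 : σ.symm = τ.symm :=
      Equiv.ext fun k => le_antisymm (key σ τ h k) (key τ σ h.symm k)
    rw [← Equiv.symm_symm σ, h2, Equiv.symm_symm]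
  have hrange : flags S = Set.range fun σ i => faceOf S (x σ i) := by
    ext f
    constructor
    · intro hf
      obtain ⟨hfv, hv⟩ := flagVertex_spec hP 0 hf
      set v := flagVertex 0 f
      -- the vertex by which the `i`-th face of the flag exceeds the previous one
      have hκ : ∀ i, ∃ k, b.coord k (v i) ≠ 0 ∧ ∀ j < i, b.coord k (v j) = 0 := by
        intro i
        refine Fin.cases ?_ (fun i => ?_) i
        · by_contra! hcon
          have h1 := b.sum_coord_apply_eq_one (v 0)
          rw [Finset.sum_eq_zero fun k _ => ?_] at h1
          · exact zero_ne_one h1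
          · by_contra h0
            obtain ⟨j, hj, -⟩ := hcon k h0
            exact absurd hj (Fin.not_lt_zero j)
        · have h1 := (hv.2 _ _ i.castSucc_lt_succ).2
          rw [faceLE_simplex_iff b (hv.1 _) (hv.1 _)] at h1
          push Not at h1
          obtain ⟨k, hk0, hk1⟩ := h1
          refine ⟨k, hk1, fun j hj => ?_⟩
          exact (faceLE_simplex_iff b (hv.1 _) (hv.1 _)).1
            (hv.faceLE (Fin.le_castSucc_iff.2 hj)) k hk0
      choose κ hκ1 hκ2 using hκ
      have hκinj : Function.Injective κ := by
        intro i j hij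
        by_contra hne
        rcases lt_or_gt_of_ne hne with h | h
        · exact hκ1 i (hij ▸ hκ2 j i h)
        · exact hκ1 j (hij ▸ hκ2 i j h)
      let σ := Equiv.ofBijective κ (Finite.injective_iff_bijective.1 hκinj)
      have hσ : ∀ i k, b.coord k (v i) = 0 ↔ ¬ σ.symm k ≤ i := by
        intro i k
        obtain ⟨j, rfl⟩ := σ.surjective k
        rw [Equiv.symm_apply_apply, not_le]
        refine ⟨fun h => ?_, fun h => hκ2 j i h⟩
        by_contra hij
        exact hκ1 j ((faceLE_simplex_iff b (hv.1 _) (hv.1 _)).1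
          (hv.faceLE (not_lt.1 hij)) _ h)
      refine ⟨σ, ?_⟩
      ext1 i
      rw [hfv]
      refine (faceOf_eq_iff hP (hxS σ i) (hv.1 i)).2 ?_
      rw [faceLE_simplex_iff b (hxS σ i) (hv.1 i), faceLE_simplex_iff b (hv.1 i) (hxS σ i)]
      exact ⟨fun k hk => (hx σ i k).2 ((hσ i k).1 hk), fun k hk => (hσ i k).2 ((hx σ i k).1 hk)⟩
    · rintro ⟨σ, rfl⟩
      exact (hchain σ).mem_flags hP
  rw [hrange, ← Set.image_univ, hinj.encard_image, Set.encard_univ, ENat.card_eq_coe_fintype_card,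
    Fintype.card_perm, Fintype.card_fin]

end SimplexFlags


end HilbertGeometry

theorem mainTheorem3 (d : ℕ)
    (h : Set (HilbertGeometry.Space d) → HilbertGeometry.Space d → ℝ)
    (hh : HilbertGeometry.IsVolumeDensity h)
    (P S : Set (HilbertGeometry.Space d))
    (hP : HilbertGeometry.IsPolytope P) (hS : HilbertGeometry.IsSimplex S)
    (p q : HilbertGeometry.Space d) (hp : p ∈ interior P) (hq : q ∈ interior S) :
    HilbertGeometry.asvol h (interior P) p =
      ((HilbertGeometry.flags P).encard : ℝ≥0∞) / ((d + 1)! : ℝ≥0∞) *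
        HilbertGeometry.asvol h (interior S) q := by
  have hSP := hS.isPolytope
  obtain ⟨b, rfl⟩ := hS.exists_affineBasis
  rw [HilbertGeometry.asvol_interior_eq hh hP hp, HilbertGeometry.asvol_interior_eq hh hSP hq,
    HilbertGeometry.encard_flags_simplex b hSP, ← mul_assoc]
  congr 1
  symm
  have h0 : ((d + 1)! : ℝ≥0∞) ≠ 0 := by exact_mod_cast (Nat.factorial_ne_zero _)
  exact ENNReal.div_mul_cancel h0 (ENNReal.natCast_ne_top _)
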